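/- Let $(X,\mathcal C,m,T)$ be a probability preserving dynamical system and let $\varphi:X\to\mathbb R$ be measurable. Put $S_0=0$, $S_n=\sum_{k=1}^{n}\varphi\circ T^{k-1}$ for $n\ge 1$. Let $\hat T:L^1(m)\to L^1(m)$ be the transfer operator, determined by $\int f\cdot (g\circ T)\,dm=\int \hat Tf\cdot g\,dm$ for $f\in L^1(m)$, $g\in L^\infty(m)$, and put $P(t)f=\hat T(e^{it\varphi}f)$ for $t\in\mathbb R$. Write $\rho(\cdot)$ for the spectral radius of a bounded operator. Assume the following. - (A1) There is a complex Banach space $\mathcal B\subseteq L^\infty(m)$ with norm $\|\cdot\|$ such that $\|\cdot\|_\infty\le C\|\cdot\|$ for some $C>0$, $\mathbf 1\in\mathcal B$, and $g\in\mathcal B$ implies $\bar g\in\mathcal B$ and $|g|\in\mathcal B$. - (A2) $\hat T$ acts on $\mathcal B$ as a bounded operator that is quasi-compact with one dominating simple eigenvalue, equal to $1$: $\mathcal B=F\oplus H$ with $F,H$ closed and $\hat T$-invariant, $F$ one-dimensional, $\hat T=\mathrm{id}$ on $F$, $\rho(\hat T)=1$ and $\rho(\hat T|_H)<1$. Moreover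 $\hat T g=m(g)\mathbf 1+Ng$ for $g\in\mathcal B$, with $\rho(N)<1$. - (A3) $\varphi\in L^2(m)$ and $m(\varphi)=0$. - (A4) Each $P(t)$ acts on $\mathcal B$ as a bounded operator, and $t\mapsto P(t)$ is continuous from $\mathbb R$ to $\mathrm{Hom}(\mathcal B,\mathcal B)$ with the operator norm. - (A5) $t\mapsto P(t)\in\mathrm{Hom}(\mathcal B,\mathcal B)$ is twice continuously differentiable on an open neighbourhood of $0$, with $P'(0)g=\hat T(i\varphi g)$ and $P''(0)g=\hat T(-\varphi^2g)$ for $g\in\mathcal B$. - (A6) The spectral radius of $P(t)$ on $\mathcal B$ satisfies $\rho(P(t))<1$ for all $t\ne 0$. - (A7) The random càdlàg functions $\omega_n(t)=n^{-1/2}S_{\lfloor nt\rfloor}$, $t\in[0,1]$, converge in law, in the space $D[0,1]$ with the Skorokhod ($J_1$) topology, to a Brownian motion $\omega$ with $E(\omega(t))=0$ for all $t$ and $E(\omega(1)^2)>0$. Let $f:\mathbb R\to\mathbb R$ be smooth, integrable and symmetric ($f(-y)=f(y)$), with compactly supported Fourier transform, and for $n\ge1$ define $$l_n(y)=n^{-1/2}\sum_{k=1}^{n}f\bigl(S_k-\sqrt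 n\,y\bigr),\qquad y\in\mathbb R .$$ Then the $l_n$ are random elements (Borel measurable functions on $X$) of the space $C(\mathbb R)$ of continuous real functions with the topology of uniform convergence on compact sets, and the sequence $(l_n)_{n\ge1}$ is tight: for every $\varepsilon>0$ there is a compact $K\subset C(\mathbb R)$ with $m(l_n\in K)>1-\varepsilon$ for all $n\ge 1$. -/

import Mathlib

open MeasureTheory ProbabilityTheory Filter Topology
open scoped NNReal ENNReal ContDiff FourierTransform

/-! ### The transfer operator and the characteristic function operators -/

section Transfer

/-- `g` is the image of `f ∈ L¹(m)` under the pre-dual of the Koopman operator `h ↦ h ∘ T`: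
`∫ f · (h ∘ T) dm = ∫ g · h dm` for all `h ∈ L^∞(m)`. -/
def IsTransfer {X : Type*} [MeasurableSpace X] (m : Measure X) (T : X → X) (f g : X → ℂ) : Prop :=
  Integrable g m ∧ ∀ h : X → ℂ, Measurable h → (∃ C : ℝ, ∀ x, ‖h x‖ ≤ C) →
    ∫ x, f x * h (T x) ∂m = ∫ x, g x * h x ∂m

/-- For a measure preserving map, the image under the transfer operator exists. -/
theorem exists_isTransfer {X : Type*} [mX : MeasurableSpace X] {m : Measure X}
    [IsProbabilityMeasure m] {T : X → X} (hT : MeasurePreserving T m m) {f : X → ℂ}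
    (hf : Integrable f m) : ∃ g, IsTransfer m T f g := by
  have hle : mX.comap T ≤ mX := hT.measurable.comap_le
  obtain ⟨g, hg, hgT⟩ := (stronglyMeasurable_condExp (m := mX.comap T) (μ := m)
    (f := f)).exists_eq_measurable_comp
  have hgi : Integrable g m := by
    rw [← hT.integrable_comp hg.aestronglyMeasurable, ← hgT]
    exact integrable_condExp
  refine ⟨g, hgi, fun h hh ⟨C, hC⟩ => ?_⟩
  have hcomp : StronglyMeasurable[mX.comap T] (fun x => h (T x)) :=
    (hh.comp (comap_measurable T)).stronglyMeasurable
  have hfh : Integrable (fun x => f x * h (T x)) m :=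
    hf.mul_bdd (c := C) (hh.comp hT.measurable).aestronglyMeasurable
      (Eventually.of_forall fun x => hC _)
  have key := condExp_bilin_of_stronglyMeasurable_right (ContinuousLinearMap.mul ℝ ℂ)
    (μ := m) hcomp (f := f) hfh hf
  have h1 : ∫ x, f x * h (T x) ∂m = ∫ x, g (T x) * h (T x) ∂m := by
    rw [← integral_condExp hle]
    refine integral_congr_ae (key.trans (Eventually.of_forall fun x => ?_))
    simp only [ContinuousLinearMap.mul_apply', hgT, Function.comp]
  rw [h1]
  have h2 : AEStronglyMeasurable (fun x => g x * h x) m :=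
    (hg.mul hh.stronglyMeasurable).aestronglyMeasurable
  have h3 := integral_map (μ := m) (φ := T) hT.measurable.aemeasurable
    (f := fun x => g x * h x) (by rw [hT.map_eq]; exact h2)
  rw [hT.map_eq] at h3
  exact h3.symm

/-- The image under the transfer operator is unique up to null sets. -/
theorem IsTransfer.ae_eq {X : Type*} [MeasurableSpace X] {m : Measure X}
    [IsProbabilityMeasure m] {T : X → X} {f g₁ g₂ : X → ℂ}
    (h₁ : IsTransfer m T f g₁) (h₂ : IsTransfer m T f g₂) : g₁ =ᵐ[m] g₂ := by
  refine Integrable.ae_eq_of_forall_setIntegral_eq _ _ h₁.1 h₂.1 fun s hs _ => ?_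
  have hb : ∃ C : ℝ, ∀ x, ‖s.indicator (fun _ => (1 : ℂ)) x‖ ≤ C :=
    ⟨1, fun x => by by_cases hx : x ∈ s <;> simp [hx]⟩
  have hm : Measurable (s.indicator (fun _ => (1 : ℂ))) := measurable_const.indicator hs
  have e := (h₁.2 _ hm hb).symm.trans (h₂.2 _ hm hb)
  have hi : ∀ g : X → ℂ, (fun x => g x * s.indicator (fun _ => (1 : ℂ)) x) = s.indicator g := by
    intro g
    ext x
    by_cases hx : x ∈ s <;> simp [hx]
  simpa only [hi, integral_indicator hs] using e

open Classical in
/-- The transfer (Frobenius-Perron) operator of `T`, on representatives of elements of `L¹(m)`. -/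
noncomputable def transferOperator {X : Type*} [MeasurableSpace X] (m : Measure X) (T : X → X)
    (f : X → ℂ) : X → ℂ :=
  if h : ∃ g, IsTransfer m T f g then h.choose else 0

/-- The defining duality of the transfer operator. -/
theorem isTransfer_transferOperator {X : Type*} [MeasurableSpace X] {m : Measure X}
    [IsProbabilityMeasure m] {T : X → X} (hT : MeasurePreserving T m m) {f : X → ℂ}
    (hf : Integrable f m) : IsTransfer m T f (transferOperator m T f) := by
  have h := exists_isTransfer hT hf
  rw [transferOperator, dif_pos h]
  exact h.choose_spec

/-- The characteristic function operator `f ↦ T̂ (e^{itφ} f)`. -/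
noncomputable def charFunOperator {X : Type*} [MeasurableSpace X] (m : Measure X) (T : X → X)
    (φ : X → ℝ) (t : ℝ) (f : X → ℂ) : X → ℂ :=
  transferOperator m T (fun x => Complex.exp (Complex.I * t * φ x) * f x)

end Transfer

/-! ### Quasi-compactness -/

/-- `A` is quasi-compact with `s` dominating simple eigenvalues `μ 0, …, μ (s - 1)`: the space
splits into closed invariant subspaces `F ⊕ H`, where `F` has a basis of `s` eigenvectors whose
eigenvalues have modulus `ρ(A)`, and the restriction of `A` to `H` has spectral radius
smaller than `ρ(A)`. -/
def IsQuasiCompact {B : Type*} [NormedAddCommGroup B] [NormedSpace ℂ B] (A : B →L[ℂ] B)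
    {s : ℕ} (μ : Fin s → ℂ) : Prop :=
  ∃ F H : Submodule ℂ B, IsCompl F H ∧ IsClosed (H : Set B) ∧ (∀ x ∈ F, A x ∈ F) ∧
    (∃ b : Module.Basis (Fin s) ℂ F, ∀ i, A (b i) = μ i • (b i : B) ∧
      (‖μ i‖₊ : ℝ≥0∞) = spectralRadius ℂ A) ∧
    ∃ hH : ∀ x : H, (A.comp H.subtypeL) x ∈ H,
      spectralRadius ℂ ((A.comp H.subtypeL).codRestrict H hH) < spectralRadius ℂ A

/-! ### The Skorokhod space `D[0,1]` -/

/-- Real càdlàg functions on `[0,1]`. -/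
structure SkorokhodSpace where
  /-- the underlying function -/
  toFun : unitInterval → ℝ
  right_continuous : ∀ t, ContinuousWithinAt toFun (Set.Ici t) t
  left_limit : ∀ t, ∃ l, Tendsto toFun (𝓝[<] t) (𝓝 l)

namespace SkorokhodSpace

/-- `y` is closer than `ε` to `x` up to a time change that is `ε`-close to the identity. -/
def Close (ε : ℝ) (x y : SkorokhodSpace) : Prop :=
  ∃ τ : unitInterval ≃o unitInterval,
    ∀ t, |(τ t : ℝ) - t| < ε ∧ |x.toFun t - y.toFun (τ t)| < ε

/-- The Skorokhod (J1) topology, the topology of the metric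
`d(x, y) = inf_τ max (sup_t |τ t - t|) (sup_t |x t - y (τ t)|)`. -/
instance : TopologicalSpace SkorokhodSpace where
  IsOpen U := ∀ x ∈ U, ∃ ε > 0, ∀ y, Close ε x y → y ∈ U
  isOpen_univ := fun _ _ => ⟨1, one_pos, fun _ _ => trivial⟩
  isOpen_inter := by
    rintro U V hU hV x ⟨hxU, hxV⟩
    obtain ⟨ε, hε, h⟩ := hU x hxU
    obtain ⟨δ, hδ, h'⟩ := hV x hxV
    refine ⟨min ε δ, lt_min hε hδ, fun y ⟨τ, hτ⟩ => ⟨h y ⟨τ, fun t => ?_⟩, h' y ⟨τ, fun t => ?_⟩⟩⟩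
    · exact ⟨(hτ t).1.trans_le (min_le_left _ _), (hτ t).2.trans_le (min_le_left _ _)⟩
    · exact ⟨(hτ t).1.trans_le (min_le_right _ _), (hτ t).2.trans_le (min_le_right _ _)⟩
  isOpen_sUnion := by
    rintro S hS x ⟨U, hU, hx⟩
    obtain ⟨ε, hε, h⟩ := hS U hU x hx
    exact ⟨ε, hε, fun y hy => ⟨U, hU, h y hy⟩⟩

instance : MeasurableSpace SkorokhodSpace := borel _

instance : BorelSpace SkorokhodSpace := ⟨rfl⟩

end SkorokhodSpace

/-- `t ↦ ⌊n t⌋` is locally constant from the right. -/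
theorem eventually_floor_right (n : ℕ) (t : unitInterval) :
    ∀ᶠ s : unitInterval in 𝓝[≥] t, ⌊(n : ℝ) * (s : ℝ)⌋₊ = ⌊(n : ℝ) * (t : ℝ)⌋₊ := by
  have hc : Continuous fun s : unitInterval => (n : ℝ) * (s : ℝ) := by fun_prop
  have h1 : ∀ᶠ s : unitInterval in 𝓝 t, (n : ℝ) * (s : ℝ) < ⌊(n : ℝ) * (t : ℝ)⌋₊ + 1 :=
    hc.continuousAt.eventually_lt_const (Nat.lt_floor_add_one _)
  filter_upwards [h1.filter_mono nhdsWithin_le_nhds, self_mem_nhdsWithin] with s hs hts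
  have hts' : (t : ℝ) ≤ s := hts
  have h2 : (n : ℝ) * (t : ℝ) ≤ n * s := by gcongr
  have h0 : (0 : ℝ) ≤ n * t := mul_nonneg (Nat.cast_nonneg _) t.2.1
  rw [Nat.floor_eq_iff (h0.trans h2)]
  exact ⟨(Nat.floor_le h0).trans h2, hs⟩

/-- `t ↦ ⌊n t⌋` is locally constant from the left. -/
theorem eventually_floor_left (n : ℕ) (t : unitInterval) :
    ∃ k : ℕ, ∀ᶠ s : unitInterval in 𝓝[<] t, ⌊(n : ℝ) * (s : ℝ)⌋₊ = k := by
  rcases Nat.eq_zero_or_pos n with rfl | hn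
  · exact ⟨0, by simp⟩
  have hn' : (0 : ℝ) < n := by exact_mod_cast hn
  refine ⟨⌈(n : ℝ) * (t : ℝ)⌉₊ - 1, ?_⟩
  have hc : Continuous fun s : unitInterval => (n : ℝ) * (s : ℝ) := by fun_prop
  rcases Nat.eq_zero_or_pos ⌈(n : ℝ) * (t : ℝ)⌉₊ with h0 | hpos
  · filter_upwards [self_mem_nhdsWithin] with s hs
    have hs' : (s : ℝ) < t := hs
    have := Nat.ceil_eq_zero.1 h0
    have h3 : (n : ℝ) * s < n * t := by gcongr
    have h4 : (0 : ℝ) ≤ n * s := mul_nonneg hn'.le s.2.1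
    linarith
  · have h1 : ∀ᶠ s : unitInterval in 𝓝 t, ((⌈(n : ℝ) * (t : ℝ)⌉₊ - 1 : ℕ) : ℝ) < (n : ℝ) * (s : ℝ) := by
      refine hc.continuousAt.eventually_const_lt ?_
      exact Nat.lt_ceil.1 (Nat.sub_lt hpos one_pos)
    filter_upwards [h1.filter_mono nhdsWithin_le_nhds, self_mem_nhdsWithin] with s hs hst
    have hst' : (s : ℝ) < t := hst
    have h3 : (n : ℝ) * s < n * t := by gcongr
    rw [Nat.floor_eq_iff (mul_nonneg hn'.le s.2.1)]
    refine ⟨hs.le, h3.trans_le ((Nat.le_ceil _).trans ?_)⟩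
    exact_mod_cast (by omega : ⌈(n : ℝ) * (t : ℝ)⌉₊ ≤ ⌈(n : ℝ) * (t : ℝ)⌉₊ - 1 + 1)

/-! ### The processes

The partial sums `S_n = φ + φ ∘ T + ⋯ + φ ∘ T^(n-1)`, `S_0 = 0`, are Mathlib's
`birkhoffSum T φ n`. -/

/-- The random càdlàg function `ω_n(t) = n^(-1/2) S_⌊nt⌋`, `0 ≤ t ≤ 1`. -/
noncomputable def partialSumPath {X : Type*} (T : X → X) (φ : X → ℝ) (n : ℕ) (x : X) :
    SkorokhodSpace where
  toFun t := (√(n : ℝ))⁻¹ * birkhoffSum T φ ⌊(n : ℝ) * (t : ℝ)⌋₊ x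
  right_continuous t := by
    refine (continuousWithinAt_const (b := (√(n : ℝ))⁻¹ *
      birkhoffSum T φ ⌊(n : ℝ) * (t : ℝ)⌋₊ x)).congr_of_eventuallyEq ?_ rfl
    filter_upwards [eventually_floor_right n t] with s hs
    rw [hs]
  left_limit t := by
    obtain ⟨k, hk⟩ := eventually_floor_left n t
    refine ⟨(√(n : ℝ))⁻¹ * birkhoffSum T φ k x, tendsto_const_nhds.congr' ?_⟩
    filter_upwards [hk] with s hs
    rw [hs]

/-- `W` is a Brownian motion on `[0,1]` with `E (W 1)² = v`, as a random element of `D[0,1]`. -/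
def IsBrownianWithVariance {Ω : Type*} [MeasurableSpace Ω] (W : Ω → SkorokhodSpace)
    (Q : Measure Ω) (v : ℝ) : Prop :=
  ∃ β : ℝ≥0 → Ω → ℝ, IsBrownianReal β Q ∧
    ∀ᵐ w ∂Q, ∀ t : unitInterval, (W w).toFun t = √v * β (Real.toNNReal t) w

/-- The random continuous function `l_n(y) = n^(-1/2) ∑_{k=1}^n f(S_k - √n y)`. -/
noncomputable def localTime {X : Type*} (T : X → X) (φ : X → ℝ) (f : C(ℝ, ℝ)) (n : ℕ) (x : X) :
    C(ℝ, ℝ) where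
  toFun y := (√(n : ℝ))⁻¹ * ∑ k ∈ Finset.Icc 1 n, f (birkhoffSum T φ k x - √(n : ℝ) * y)
  continuous_toFun := by fun_prop

/-- The Borel σ-algebra of `C(ℝ)` with the topology of uniform convergence on compact sets
(which is Mathlib's compact-open topology). -/
instance : MeasurableSpace C(ℝ, ℝ) := borel _

instance : BorelSpace C(ℝ, ℝ) := ⟨rfl⟩

/-! Tightness follows from Kolmogorov's criterion, once `l_n(y)` has a uniformly bounded fourth
moment and `E |l_n(y) - l_n(z)|^4 ≤ K |y - z|^(4/3)` with `K` independent of `n`.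

Fourier inversion writes `f(S_k - √n y)` as a superposition of the characters `exp(iξ S_k)` with a
compactly supported density `ψ`. Expectations of products of such characters are powers of the
operators `P(u)` applied to the constant `1` and integrated. The fourth moment is thus controlled by
sums of `‖P(u)^j‖` (`exists_integral_sum_pow_four_le`).

The decisive estimate is diffusive: `∑_{j ≤ n} ‖P(u)^j‖ ≤ C n / (1 + √n |u|)^2` for bounded `u`,
that is, of order `min(n, u⁻²)` (`exists_sum_norm_pow_le`). Away from `u = 0` it comes from spectral
radius smaller than one and compactness. Near `0` no eigenvalue expansion is used. Let `π = m(·)1`.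
For a fixed large `k` and small `u`, `P(u)^k` is close to `π`, so `P(u)^(k+n+k)` is close to `π
P(u)^n π = E(exp(iu S_n)) π`. The invariance principle at time one gives the central limit theorem,
which makes this expectation small for some `n` of order `u⁻²`. Hence some power of that order has
norm at most `1/2`, and the norms of all powers sum to `O(u⁻²)`.

For an increment, the phases contribute `|exp(-iξ√n y) - exp(-iξ√n z)| ≤ 2 |y - z|^(1/3) (1 + √n
|ξ|)^(1/3)`. Each of the four summations over time yields a factor `n (1 + √n |ζ|)^(-2)`. Two
weights of exponent `1/3` reduce the decay to `-4/3`, which is still integrable, and the integration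
over the frequency yields `n^(-1/2)`. Four rounds give `n^2 |y - z|^(4/3)`, and the normalisation of
`l_n` removes `n^2`. A Hölder exponent `θ` works in this scheme when `4θ > 1` and `2 - 2θ > 1`;
`1/3` is such a choice. -/

/-! ### A Kolmogorov criterion for tightness in `C(ℝ)` -/

section Tightness

/-- Dyadic chaining: a continuous function with geometrically small increments between
neighbouring dyadic points of `[-L, L]` has a modulus of continuity on `[-L, L]`. -/
theorem abs_sub_le_of_dyadic_increments {g : ℝ → ℝ} (hg : Continuous g) {L : ℕ} {A r : ℝ}
    (hA : 0 ≤ A) (hr0 : 0 ≤ r) (hr1 : r < 1)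
    (h : ∀ j : ℕ, ∀ i : ℤ, -(L * 2 ^ j : ℤ) ≤ i → i < (L * 2 ^ j : ℤ) →
      |g ((i + 1) / 2 ^ j) - g (i / 2 ^ j)| ≤ A * r ^ j)
    {s t : ℝ} (hs : |s| ≤ L) (ht : |t| ≤ L) (j : ℕ) (hst : |s - t| ≤ (2 ^ j)⁻¹) :
    |g s - g t| ≤ A * (1 + 2 / (1 - r)) * r ^ j := by
  have h1r : 0 < 1 - r := by linarith
  have floor_ge : ∀ {u : ℝ}, |u| ≤ L → ∀ k : ℕ, -(L * 2 ^ k : ℤ) ≤ ⌊2 ^ k * u⌋ := by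
    intro u hu k
    rw [Int.le_floor]
    push_cast
    have := (abs_le.1 hu).1
    have h2 : (0 : ℝ) < 2 ^ k := by positivity
    nlinarith
  have le_floor : ∀ {u : ℝ}, |u| ≤ L → ∀ k : ℕ, ⌊2 ^ k * u⌋ ≤ (L * 2 ^ k : ℤ) := by
    intro u hu k
    have h3 : ((⌊2 ^ k * u⌋ : ℤ) : ℝ) ≤ L * 2 ^ k := by
      refine (Int.floor_le _).trans ?_
      have := (abs_le.1 hu).2
      have h2 : (0 : ℝ) < 2 ^ k := by positivity
      nlinarith
    exact_mod_cast h3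
  have step : ∀ {u : ℝ}, |u| ≤ L → ∀ k : ℕ,
      |g (⌊2 ^ (k + 1) * u⌋ / 2 ^ (k + 1)) - g (⌊2 ^ k * u⌋ / 2 ^ k)| ≤ A * r ^ (k + 1) := by
    intro u hu k
    have e1 : (2 : ℝ) ^ (k + 1) * u = 2 * (2 ^ k * u) := by ring
    have hlow : 2 * ⌊2 ^ k * u⌋ ≤ ⌊2 ^ (k + 1) * u⌋ := by
      rw [Int.le_floor, e1]
      push_cast
      linarith [Int.floor_le (2 ^ k * u)]
    have hup : ⌊2 ^ (k + 1) * u⌋ < 2 * ⌊2 ^ k * u⌋ + 2 := by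
      rw [Int.floor_lt, e1]
      push_cast
      linarith [Int.lt_floor_add_one (2 ^ k * u)]
    have e2 : (⌊2 ^ k * u⌋ : ℝ) / 2 ^ k = ((2 * ⌊2 ^ k * u⌋ : ℤ) : ℝ) / 2 ^ (k + 1) := by
      push_cast
      rw [pow_succ]
      field_simp
    -- Refining the grid either keeps the dyadic approximation of `u` or moves it one fine step to
    -- the right.
    rcases (by omega : ⌊2 ^ (k + 1) * u⌋ = 2 * ⌊2 ^ k * u⌋ ∨
      ⌊2 ^ (k + 1) * u⌋ = 2 * ⌊2 ^ k * u⌋ + 1) with h0 | h0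
    · rw [e2, h0, sub_self, abs_zero]
      positivity
    · have := h (k + 1) (2 * ⌊2 ^ k * u⌋) (by have := floor_ge hu k; rw [pow_succ]; linarith)
        (by have := le_floor hu (k + 1); omega)
      rw [e2, h0]
      push_cast at this ⊢
      exact this
  have tele : ∀ {u : ℝ}, |u| ≤ L → ∀ d : ℕ,
      |g (⌊2 ^ (j + d) * u⌋ / 2 ^ (j + d)) - g (⌊2 ^ j * u⌋ / 2 ^ j)|
        ≤ A * ((r ^ j - r ^ (j + d)) / (1 - r)) := by
    intro u hu d
    induction d with
    | zero => simp
    | succ d ih =>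
      have e3 : A * ((r ^ j - r ^ (j + (d + 1))) / (1 - r)) =
          A * r ^ (j + d) + A * ((r ^ j - r ^ (j + d)) / (1 - r)) := by
        rw [← add_assoc, pow_succ]
        field_simp
        ring
      rw [e3]
      refine (abs_sub_le _ _ _).trans (add_le_add ((step hu (j + d)).trans ?_) ih)
      -- One factor `r` is given away so that the increments telescope exactly against `(r ^ j - r ^
      -- (j + d)) / (1 - r)`.
      exact mul_le_mul_of_nonneg_left (pow_le_pow_of_le_one hr0 hr1.le (by omega)) hA
  have lim : ∀ {u : ℝ}, |u| ≤ L → |g u - g (⌊2 ^ j * u⌋ / 2 ^ j)| ≤ A * (r ^ j / (1 - r)) := by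
    intro u hu
    have hd : Tendsto (fun d : ℕ => (⌊2 ^ (j + d) * u⌋ : ℝ) / 2 ^ (j + d)) atTop (𝓝 u) := by
      have hp : Tendsto (fun d : ℕ => (2 : ℝ) ^ (j + d)) atTop atTop :=
        (tendsto_pow_atTop_atTop_of_one_lt one_lt_two).comp (tendsto_add_atTop_nat j |>.congr
          fun d => by rw [add_comm])
      have h5 : Tendsto (fun x : ℝ => (⌊u * x⌋ : ℝ) / x) atTop (𝓝 u) := by
        have hinv := tendsto_inv_atTop_zero (𝕜 := ℝ)
        refine tendsto_of_tendsto_of_tendsto_of_le_of_le' (g := fun x => u - x⁻¹)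
          (h := fun _ => u) (by simpa using tendsto_const_nhds.sub hinv) tendsto_const_nhds ?_ ?_
        · filter_upwards [eventually_gt_atTop 0] with x hx
          rw [le_div_iff₀ hx]
          have := Int.lt_floor_add_one (u * x)
          field_simp
          linarith
        · filter_upwards [eventually_gt_atTop 0] with x hx
          rw [div_le_iff₀ hx]
          exact Int.floor_le _
      refine (h5.comp hp).congr fun d => ?_
      simp [mul_comm]
    have hc := ((hg.tendsto u).comp hd).sub_const (g (⌊2 ^ j * u⌋ / 2 ^ j)) |>.abs
    refine le_of_tendsto hc (Eventually.of_forall fun d => (tele hu d).trans ?_)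
    have : 0 ≤ r ^ (j + d) := pow_nonneg hr0 _
    gcongr
    linarith
  -- Points at distance at most `2 ^ (-j)` have level-`j` floors that differ by at most one, so a
  -- single increment joins the two chains.
  have mid : |g (⌊2 ^ j * s⌋ / 2 ^ j) - g (⌊2 ^ j * t⌋ / 2 ^ j)| ≤ A * r ^ j := by
    have h2 : (0 : ℝ) < 2 ^ j := by positivity
    have hb := abs_le.1 hst
    have hb1 : 2 ^ j * s - 2 ^ j * t ≤ 1 := by
      have := mul_le_mul_of_nonneg_left hb.2 h2.le
      rw [mul_inv_cancel₀ h2.ne'] at this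
      linarith
    have hb2 : 2 ^ j * t - 2 ^ j * s ≤ 1 := by
      have := mul_le_mul_of_nonneg_left hb.1 h2.le
      rw [mul_neg, mul_inv_cancel₀ h2.ne'] at this
      linarith
    have a1 := Int.floor_le (2 ^ j * s)
    have a2 := Int.lt_floor_add_one (2 ^ j * s)
    have a3 := Int.floor_le (2 ^ j * t)
    have a4 := Int.lt_floor_add_one (2 ^ j * t)
    have c1 : ⌊2 ^ j * s⌋ < ⌊2 ^ j * t⌋ + 2 := by
      have : (⌊2 ^ j * s⌋ : ℝ) < ⌊2 ^ j * t⌋ + 2 := by linarith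
      exact_mod_cast this
    have c2 : ⌊2 ^ j * t⌋ < ⌊2 ^ j * s⌋ + 2 := by
      have : (⌊2 ^ j * t⌋ : ℝ) < ⌊2 ^ j * s⌋ + 2 := by linarith
      exact_mod_cast this
    rcases (by omega : ⌊2 ^ j * s⌋ = ⌊2 ^ j * t⌋ ∨ ⌊2 ^ j * s⌋ = ⌊2 ^ j * t⌋ + 1 ∨
      ⌊2 ^ j * t⌋ = ⌊2 ^ j * s⌋ + 1) with h0 | h0 | h0
    · rw [h0, sub_self, abs_zero]
      positivity
    · have := h j _ (floor_ge ht j) (by have := le_floor hs j; omega)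
      rw [h0]
      push_cast
      exact this
    · have := h j _ (floor_ge hs j) (by have := le_floor ht j; omega)
      rw [h0, abs_sub_comm]
      push_cast
      exact this
  have e4 : A * (1 + 2 / (1 - r)) * r ^ j =
      A * (r ^ j / (1 - r)) + A * r ^ j + A * (r ^ j / (1 - r)) := by
    field_simp
    ring
  rw [e4]
  have hlt := lim ht
  rw [abs_sub_comm] at hlt
  have t1 := abs_sub_le (g s) (g (⌊2 ^ j * s⌋ / 2 ^ j)) (g (⌊2 ^ j * t⌋ / 2 ^ j))
  have t2 := abs_sub_le (g s) (g (⌊2 ^ j * t⌋ / 2 ^ j)) (g t)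
  linarith [lim hs]

/-- Functions with prescribed bounds at the integers and a prescribed geometric modulus of
continuity on each `[-L, L]` form a compact subset of `C(ℝ)`. -/
theorem isCompact_setOf_modulus (a : ℤ → ℝ) (A : ℕ → ℝ) {r : ℝ} (hr0 : 0 ≤ r) (hr1 : r < 1) :
    IsCompact {g : C(ℝ, ℝ) | (∀ k : ℤ, |g k| ≤ a k) ∧ ∀ (L j : ℕ) (s t : ℝ), |s| ≤ L → |t| ≤ L →
      |s - t| ≤ (2 ^ j)⁻¹ → |g s - g t| ≤ A L * r ^ j} := by
  set S := {g : C(ℝ, ℝ) | (∀ k : ℤ, |g k| ≤ a k) ∧ ∀ (L j : ℕ) (s t : ℝ), |s| ≤ L → |t| ≤ L →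
      |s - t| ≤ (2 ^ j)⁻¹ → |g s - g t| ≤ A L * r ^ j} with hS
  have modulus : ∀ (g : ℝ → ℝ), (∀ (L j : ℕ) (s t : ℝ), |s| ≤ L → |t| ≤ L →
      |s - t| ≤ (2 ^ j)⁻¹ → |g s - g t| ≤ A L * r ^ j) → ∀ t : ℝ, ∀ ε > 0, ∀ j : ℕ,
      A (⌈|t|⌉₊ + 1) * r ^ j < ε → ∀ s, dist s t < (2 ^ j)⁻¹ → |g t - g s| < ε := by
    intro g hg t ε hε j hj s hst
    rw [Real.dist_eq] at hst
    have h1 : |t| ≤ ((⌈|t|⌉₊ + 1 : ℕ) : ℝ) := by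
      push_cast
      linarith [Nat.le_ceil |t|]
    have h2 : |s| ≤ ((⌈|t|⌉₊ + 1 : ℕ) : ℝ) := by
      have : ((2 : ℝ) ^ j)⁻¹ ≤ 1 := inv_le_one_of_one_le₀ (one_le_pow₀ one_le_two)
      have h3 := abs_sub_abs_le_abs_sub s t
      push_cast
      linarith [Nat.le_ceil |t|]
    exact (hg _ j t s h1 h2 (by rw [abs_sub_comm]; exact hst.le)).trans_lt hj
  have exj : ∀ (t : ℝ), ∀ ε > 0, ∃ j : ℕ, A (⌈|t|⌉₊ + 1) * r ^ j < ε := by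
    intro t ε hε
    have := (tendsto_pow_atTop_nhds_zero_of_lt_one hr0 hr1).const_mul (A (⌈|t|⌉₊ + 1))
    rw [mul_zero] at this
    exact (this.eventually_lt_const hε).exists
  -- Compactness is needed for the image in the product `ℝ → ℝ`. The modulus forces continuity, so
  -- that image is cut out by pointwise closed conditions alone. The radius `⌈|t|⌉₊ + 1` leaves room
  -- for all points within distance one of `t`.
  refine ArzelaAscoli.isCompact_of_equicontinuous S ?_ ?_
  · set S' := {g : ℝ → ℝ | (∀ k : ℤ, |g k| ≤ a k) ∧ ∀ (L j : ℕ) (s t : ℝ), |s| ≤ L → |t| ≤ L →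
      |s - t| ≤ (2 ^ j)⁻¹ → |g s - g t| ≤ A L * r ^ j} with hS'
    have himg : ContinuousMap.toFun '' S = S' := by
      ext g
      constructor
      · rintro ⟨g, hg, rfl⟩
        exact hg
      · intro hg
        have hc : Continuous g := by
          rw [Metric.continuous_iff]
          intro t ε hε
          obtain ⟨j, hj⟩ := exj t ε hε
          refine ⟨(2 ^ j)⁻¹, by positivity, fun s hs => ?_⟩
          rw [dist_comm, Real.dist_eq]
          exact modulus g hg.2 t ε hε j hj s hs
        exact ⟨⟨g, hc⟩, hg, rfl⟩
    rw [himg]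
    have hcl : IsClosed S' := by
      simp only [hS', Set.ofPred_and, Set.ofPred_forall]
      refine IsClosed.inter (isClosed_iInter fun k => ?_) ?_
      · exact isClosed_le (by fun_prop) continuous_const
      · refine isClosed_iInter fun L => isClosed_iInter fun j => isClosed_iInter fun s =>
          isClosed_iInter fun t => isClosed_iInter fun _ => isClosed_iInter fun _ =>
          isClosed_iInter fun _ => ?_
        exact isClosed_le (by fun_prop) continuous_const
    refine (isCompact_univ_pi (X := fun _ : ℝ => ℝ) (s := fun t =>
      Set.Icc (-(a ⌊t⌋ + A (⌈|t|⌉₊ + 1))) (a ⌊t⌋ + A (⌈|t|⌉₊ + 1)))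
      fun t => isCompact_Icc).of_isClosed_subset hcl ?_
    rintro g ⟨hg1, hg2⟩ t -
    have h1 : |t| ≤ ((⌈|t|⌉₊ + 1 : ℕ) : ℝ) := by
      push_cast
      linarith [Nat.le_ceil |t|]
    have h3 : |t - ⌊t⌋| ≤ 1 := by
      rw [abs_of_nonneg (by linarith [Int.floor_le t])]
      linarith [Int.lt_floor_add_one t]
    have h2 : |(⌊t⌋ : ℝ)| ≤ ((⌈|t|⌉₊ + 1 : ℕ) : ℝ) := by
      have := abs_sub_abs_le_abs_sub (⌊t⌋ : ℝ) t
      rw [abs_sub_comm] at this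
      push_cast
      linarith [Nat.le_ceil |t|]
    have h4 := hg2 _ 0 t ⌊t⌋ h1 h2 (by simpa using h3)
    rw [pow_zero, mul_one] at h4
    refine abs_le.1 ?_
    have := abs_sub_abs_le_abs_sub (g t) (g ⌊t⌋)
    linarith [hg1 ⌊t⌋]
  · intro t
    rw [Metric.equicontinuousAt_iff]
    intro ε hε
    obtain ⟨j, hj⟩ := exj t ε hε
    refine ⟨(2 ^ j)⁻¹, by positivity, fun s hs g => ?_⟩
    rw [Real.dist_eq]
    exact modulus g.1 g.2.2 t ε hε j hj s hs

/-- Kolmogorov's tightness criterion in `C(ℝ)`. -/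
theorem isTightMeasureSet_of_increments {κ Ω : Type*} [MeasurableSpace Ω] (μ : Measure Ω)
    (Y : κ → Ω → C(ℝ, ℝ)) (hY : ∀ i, Measurable (Y i)) {C p β : ℝ} (hC : 0 ≤ C) (hp : 0 < p)
    (hβ : 0 < β)
    (hpt : ∀ i t a, 0 < a → μ {w | a ≤ |Y i w t|} ≤ ENNReal.ofReal (C / a ^ p))
    (hinc : ∀ i s t a, 0 < a →
      μ {w | a ≤ |Y i w s - Y i w t|} ≤ ENNReal.ofReal (C * |s - t| ^ (1 + β) / a ^ p)) :
    IsTightMeasureSet {ν : Measure C(ℝ, ℝ) | ∃ i, ν = μ.map (Y i)} := by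
  rw [isTightMeasureSet_iff_exists_isCompact_measure_compl_le]
  intro ε hε
  -- The gain `2 ^ (-β j)` is split in two halves: one pays for the shrinking thresholds `A r ^ j`,
  -- where `r ^ p = q`, and the other makes the failure probabilities summable over the levels.
  set q : ℝ := 2 ^ (-(β / 2)) with hq
  have hq0 : 0 < q := by positivity
  have hq1 : q < 1 := Real.rpow_lt_one_of_one_lt_of_neg one_lt_two (by linarith)
  set r : ℝ := q ^ p⁻¹ with hr
  have hr0 : 0 < r := by positivity
  have hr1 : r < 1 := Real.rpow_lt_one hq0.le hq1 (by positivity)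
  have hrp : ∀ j : ℕ, (r ^ j) ^ p = q ^ j := by
    intro j
    rw [hr, ← Real.rpow_natCast, ← Real.rpow_mul hq0.le, ← Real.rpow_mul hq0.le,
      ← Real.rpow_natCast]
    congr 1
    field_simp
  have h2q : ∀ j : ℕ, |((2 : ℝ) ^ j)⁻¹| ^ (1 + β) = (2 ^ j)⁻¹ * (q ^ j * q ^ j) := by
    intro j
    rw [abs_of_pos (by positivity), Real.rpow_add (by positivity), Real.rpow_one,
      hq, ← Real.rpow_natCast (2 ^ (-(β / 2)) : ℝ), ← Real.rpow_mul zero_le_two,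
      ← Real.rpow_add two_pos, ← Real.rpow_natCast 2 j, ← Real.rpow_neg zero_le_two,
      ← Real.rpow_mul zero_le_two]
    congr 2
    ring
  -- the size of a bound that makes a probability small
  have large : ∀ c : ℝ, ∀ δ : ℝ≥0∞, δ ≠ 0 → ∃ a : ℝ, 0 < a ∧ ENNReal.ofReal (c / a ^ p) ≤ δ := by
    intro c δ hδ
    have h1 : Tendsto (fun a : ℝ => ENNReal.ofReal (c / a ^ p)) atTop (𝓝 0) := by
      have := ENNReal.tendsto_ofReal (((tendsto_rpow_atTop hp).inv_tendsto_atTop).const_mul c)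
      simpa [div_eq_mul_inv] using this
    obtain ⟨a, ha, ha0⟩ := ((h1.eventually_le_const (pos_iff_ne_zero.2 hδ)).and
      (eventually_gt_atTop 0)).exists
    exact ⟨a, ha0, ha⟩
  obtain ⟨δ, hδ, hδs⟩ := ENNReal.exists_pos_sum_of_countable' (ENNReal.half_pos hε.ne').ne' ℤ
  obtain ⟨δ', hδ', hδs'⟩ := ENNReal.exists_pos_sum_of_countable' (ENNReal.half_pos hε.ne').ne' ℕ
  choose a ha ha' using fun k : ℤ => large C (δ k) (hδ k).ne'
  choose A hA hA' using fun L : ℕ => large (2 * L * C * (1 - q)⁻¹) (δ' L) (hδ' L).ne'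
  set K := {g : C(ℝ, ℝ) | (∀ k : ℤ, |g k| ≤ a k) ∧ ∀ (L j : ℕ) (s t : ℝ), |s| ≤ L → |t| ≤ L →
      |s - t| ≤ (2 ^ j)⁻¹ → |g s - g t| ≤ A L * (1 + 2 / (1 - r)) * r ^ j} with hK
  have hKc : IsCompact K :=
    isCompact_setOf_modulus a (fun L => A L * (1 + 2 / (1 - r))) hr0.le hr1
  refine ⟨K, hKc, ?_⟩
  rintro ν ⟨i, rfl⟩
  rw [Measure.map_apply (hY i) hKc.measurableSet.compl]
  have hsub : Y i ⁻¹' Kᶜ ⊆ (⋃ k : ℤ, {w | a k ≤ |Y i w k|}) ∪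
      ⋃ L : ℕ, ⋃ j : ℕ, ⋃ l ∈ Finset.Ico (-(L * 2 ^ j : ℤ)) (L * 2 ^ j),
        {w | A L * r ^ j ≤ |Y i w ((l + 1) / 2 ^ j) - Y i w (l / 2 ^ j)|} := by
    intro w hw
    by_contra hcon
    simp only [Set.mem_union, Set.mem_iUnion, Set.mem_ofPred_eq, not_or, not_exists, not_le,
      Finset.mem_Ico] at hcon
    refine hw ⟨fun k => (hcon.1 k).le, fun L j s t hs ht hst => ?_⟩
    exact abs_sub_le_of_dyadic_increments (Y i w).continuous (hA L).le hr0.le hr1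
      (fun j l hl hl' => (hcon.2 L j l ⟨hl, hl'⟩).le) hs ht j hst
  refine (measure_mono hsub).trans ((measure_union_le _ _).trans ?_)
  rw [← ENNReal.add_halves ε]
  refine add_le_add ?_ ?_
  · exact (measure_iUnion_le _).trans
      ((ENNReal.tsum_le_tsum fun k : ℤ => (hpt i k _ (ha k)).trans (ha' k)).trans hδs.le)
  · refine (measure_iUnion_le _).trans ((ENNReal.tsum_le_tsum fun L => ?_).trans hδs'.le)
    refine le_trans ?_ (hA' L)
    refine (measure_iUnion_le _).trans ?_
    -- At level `j` there are `2 L 2 ^ j` increments, each exceeding its threshold with probability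
    -- at most `C / A ^ p * 2 ^ (-j) * q ^ j`.
    have hterm : ∀ j : ℕ, μ (⋃ l ∈ Finset.Ico (-(L * 2 ^ j : ℤ)) (L * 2 ^ j),
        {w | A L * r ^ j ≤ |Y i w ((l + 1) / 2 ^ j) - Y i w (l / 2 ^ j)|})
        ≤ ENNReal.ofReal (2 * L * C / A L ^ p * q ^ j) := by
      intro j
      refine (measure_biUnion_finset_le _ _).trans ?_
      have hl : ∀ l ∈ Finset.Ico (-(L * 2 ^ j : ℤ)) (L * 2 ^ j),
          μ {w | A L * r ^ j ≤ |Y i w ((l + 1) / 2 ^ j) - Y i w (l / 2 ^ j)|}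
          ≤ ENNReal.ofReal (C / A L ^ p * ((2 ^ j)⁻¹ * q ^ j)) := by
        intro l _
        refine (hinc i _ _ _ (mul_pos (hA L) (pow_pos hr0 j))).trans (le_of_eq ?_)
        have e1 : ((l : ℝ) + 1) / 2 ^ j - l / 2 ^ j = (2 ^ j)⁻¹ := by
          field_simp
          ring
        have := Real.rpow_pos_of_pos (hA L) p
        rw [e1, h2q, Real.mul_rpow (hA L).le (pow_pos hr0 j).le, hrp]
        congr 1
        field_simp
      refine (Finset.sum_le_sum hl).trans (le_of_eq ?_)
      rw [Finset.sum_const, nsmul_eq_mul, Int.card_Ico, ← ENNReal.ofReal_natCast,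
        ← ENNReal.ofReal_mul (by positivity)]
      congr 1
      have e2 : (((L * 2 ^ j : ℤ) - -(L * 2 ^ j : ℤ)).toNat : ℝ) = 2 * L * 2 ^ j := by
        have : ((L * 2 ^ j : ℤ) - -(L * 2 ^ j : ℤ)).toNat = 2 * L * 2 ^ j := by
          rw [sub_neg_eq_add, ← two_mul, ← mul_assoc]
          exact_mod_cast Int.toNat_natCast _
        rw [this]
        push_cast
        ring
      rw [e2]
      field_simp
    have hnn : 0 ≤ 2 * L * C / A L ^ p := by
      have := Real.rpow_pos_of_pos (hA L) p
      positivity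
    refine (ENNReal.tsum_le_tsum hterm).trans (le_of_eq ?_)
    rw [← ENNReal.ofReal_tsum_of_nonneg (fun j => mul_nonneg hnn (pow_nonneg hq0.le j))
      ((summable_geometric_of_lt_one hq0.le hq1).mul_left _), tsum_mul_left,
      tsum_geometric_of_lt_one hq0.le hq1]
    congr 1
    ring

end Tightness

/-! ### Powers of operators -/

section Powers

/-- If some power of `a` has norm at most `1/2`, the powers of `a` have summable norms. -/
theorem sum_norm_pow_le_of_norm_pow_le_half {R : Type*} [NormedRing R] {a : R} {q : ℕ} {M : ℝ}
    (hq : 1 ≤ q) (haq : ‖a ^ q‖ ≤ 1 / 2) (hM : ∀ j < q, ‖a ^ j‖ ≤ M) (n : ℕ) :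
    ∑ j ∈ Finset.range n, ‖a ^ j‖ ≤ 2 * M * q := by
  have hM0 : 0 ≤ M := (norm_nonneg _).trans (hM 0 hq)
  have hfirst : ∀ k ≤ q, ∑ j ∈ Finset.range k, ‖a ^ j‖ ≤ q * M := by
    intro k hk
    refine (Finset.sum_le_sum fun j hj => hM j ((Finset.mem_range.1 hj).trans_le hk)).trans ?_
    rw [Finset.sum_const, Finset.card_range, nsmul_eq_mul]
    gcongr
  have hqM : 0 ≤ q * M := by positivity
  induction n using Nat.strong_induction_on with
  | _ n ih =>
    rcases le_total n q with h | h
    · linarith [hfirst n h]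
    · obtain ⟨d, rfl⟩ := Nat.exists_eq_add_of_le h
      rw [Finset.sum_range_add]
      -- Beyond the first block the sum is at most half of a shorter sum of the same kind, and `q M
      -- + (1/2) (2 M q) = 2 M q` closes the induction.
      have h1 : ∑ j ∈ Finset.range d, ‖a ^ (q + j)‖ ≤
          1 / 2 * ∑ j ∈ Finset.range d, ‖a ^ j‖ := by
        rw [Finset.mul_sum]
        refine Finset.sum_le_sum fun j _ => ?_
        rw [pow_add]
        exact (norm_mul_le _ _).trans (mul_le_mul_of_nonneg_right haq (norm_nonneg _))
      have h2 := ih d (by omega)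
      linarith [hfirst q le_rfl]

/-- The powers of an element of spectral radius smaller than one tend to zero. -/
theorem tendsto_norm_pow_of_spectralRadius_lt_one {R : Type*} [NormedRing R] [NormedAlgebra ℂ R]
    [CompleteSpace R] {a : R} (ha : spectralRadius ℂ a < 1) :
    Tendsto (fun n : ℕ => ‖a ^ n‖) atTop (𝓝 0) := by
  obtain ⟨r, hr, hr1⟩ := exists_between ha
  lift r to ℝ≥0 using (hr1.trans ENNReal.one_lt_top).ne
  have hr1' : (r : ℝ) < 1 := by exact_mod_cast hr1
  have h := (spectrum.pow_nnnorm_pow_one_div_tendsto_nhds_spectralRadius a).eventually_lt_const hr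
  refine squeeze_zero' (Eventually.of_forall fun n => norm_nonneg _) ?_
    (tendsto_pow_atTop_nhds_zero_of_lt_one r.2 hr1')
  filter_upwards [h, eventually_gt_atTop 0] with n hn hn0
  have h1 : (‖a ^ n‖₊ : ℝ≥0∞) ≤ (r : ℝ≥0∞) ^ n := by
    have := ENNReal.rpow_le_rpow hn.le (Nat.cast_nonneg n : (0 : ℝ) ≤ n)
    rwa [← ENNReal.rpow_mul, one_div, inv_mul_cancel₀ (by exact_mod_cast hn0.ne'),
      ENNReal.rpow_one, ENNReal.rpow_natCast] at this
  exact_mod_cast h1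

variable {B : Type*} [NormedAddCommGroup B] [NormedSpace ℂ B]

/-- A family of operators that is close to a rank one projection `ℓ(·) e` after finitely many steps
and whose powers are bounded after composition with `ℓ` is uniformly power bounded near `0`. -/
theorem exists_norm_pow_le {P : ℝ → B →L[ℂ] B} (hP : Continuous P) (ℓ : B →L[ℂ] ℂ) (e : B)
    (hπ : Tendsto (fun k : ℕ => P 0 ^ k) atTop (𝓝 (ℓ.smulRight e))) {C : ℝ}
    (hC : ∀ u n g, ‖ℓ ((P u ^ n) g)‖ ≤ C * ‖g‖) :
    ∃ δ > (0 : ℝ), ∃ M : ℝ, ∀ u : ℝ, |u| ≤ δ → ∀ n, ‖P u ^ n‖ ≤ M := by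
  obtain ⟨k, hk, hk1⟩ := ((Metric.tendsto_nhds.1 hπ (1 / 4) (by norm_num)).and
    (eventually_ge_atTop 1)).exists
  have hck : Continuous fun u => P u ^ k := hP.pow k
  have hcsum : Continuous fun u => ∑ j ∈ Finset.range k, ‖P u ^ j‖ := by fun_prop
  have h1 : ∀ᶠ u in 𝓝 (0 : ℝ), dist (P u ^ k) (ℓ.smulRight e) < 1 / 2 := by
    have : Tendsto (fun u => dist (P u ^ k) (ℓ.smulRight e)) (𝓝 0) (𝓝 _) :=
      (hck.dist continuous_const).tendsto 0
    exact this.eventually_lt_const (hk.trans (by norm_num))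
  set S := ∑ j ∈ Finset.range k, ‖P 0 ^ j‖ with hS
  have h2 : ∀ᶠ u in 𝓝 (0 : ℝ), ∑ j ∈ Finset.range k, ‖P u ^ j‖ < S + 1 :=
    (hcsum.tendsto 0).eventually_lt_const (lt_add_one _)
  obtain ⟨δ, hδ, hball⟩ := Metric.eventually_nhds_iff.1 (h1.and h2)
  have hC0 : 0 ≤ |C| * ‖e‖ := by positivity
  -- The bound `M` is chosen so that `|C| ‖e‖ + M / 2 ≤ M`: the projected part of `P u ^ (k + d)`
  -- costs `|C| ‖e‖`, the remainder at most half of the inductive bound.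
  refine ⟨δ / 2, by positivity, 2 * (|C| * ‖e‖) + (S + 1), fun u hu => ?_⟩
  obtain ⟨hu1, hu2⟩ := hball (y := u) (by rw [Real.dist_eq, sub_zero]; linarith)
  have hS0 : 0 ≤ ∑ j ∈ Finset.range k, ‖P u ^ j‖ := Finset.sum_nonneg fun _ _ => norm_nonneg _
  intro n
  induction n using Nat.strong_induction_on with
  | _ n ih =>
    rcases lt_or_ge n k with h | h
    · have := Finset.single_le_sum (f := fun j => ‖P u ^ j‖) (fun _ _ => norm_nonneg _)
        (Finset.mem_range.2 h)
      linarith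
    · obtain ⟨d, rfl⟩ := Nat.exists_eq_add_of_le h
      have e1 : P u ^ (k + d) = (ℓ.smulRight e) * P u ^ d +
          (P u ^ k - ℓ.smulRight e) * P u ^ d := by
        rw [pow_add]
        noncomm_ring
      have n1 : ‖(ℓ.smulRight e) * P u ^ d‖ ≤ |C| * ‖e‖ := by
        refine ContinuousLinearMap.opNorm_le_bound _ hC0 fun g => ?_
        rw [mul_apply_eq_comp, ContinuousLinearMap.smulRight_apply, norm_smul]
        calc _ ≤ |C| * ‖g‖ * ‖e‖ := by
              gcongr
              exact (hC u d g).trans (by gcongr; exact le_abs_self C)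
          _ = _ := by ring
      have n2 : ‖(P u ^ k - ℓ.smulRight e) * P u ^ d‖ ≤
          1 / 2 * (2 * (|C| * ‖e‖) + (S + 1)) := by
        refine (norm_mul_le _ _).trans ?_
        rw [dist_eq_norm] at hu1
        exact mul_le_mul hu1.le (ih d (by omega)) (norm_nonneg _) (by norm_num)
      rw [e1]
      refine (norm_add_le _ _).trans ?_
      linarith

/-- If moreover `ℓ (P u ^ n e)` is small for some `n` of order `u⁻²`, then `P u ^ q` has norm at
most `1/2` for some `q` of order `u⁻²`. -/
theorem exists_norm_pow_le_half {P : ℝ → B →L[ℂ] B} (hP : Continuous P) (ℓ : B →L[ℂ] ℂ) (e : B)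
    (hπ : Tendsto (fun k : ℕ => P 0 ^ k) atTop (𝓝 (ℓ.smulRight e)))
    {δ₀ M : ℝ} (hδ₀ : 0 < δ₀) (hM : ∀ u, |u| ≤ δ₀ → ∀ n, ‖P u ^ n‖ ≤ M)
    (hclt : ∀ ε > (0 : ℝ), ∃ A : ℝ, ∃ δ > (0 : ℝ), ∀ u : ℝ, u ≠ 0 → |u| ≤ δ →
      ∃ n : ℕ, n ≤ A / u ^ 2 ∧ ‖ℓ ((P u ^ n) e)‖ ≤ ε) :
    ∃ δ > (0 : ℝ), ∃ A : ℝ, ∀ u : ℝ, u ≠ 0 → |u| ≤ δ →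
      ∃ q : ℕ, 1 ≤ q ∧ q ≤ A / u ^ 2 ∧ ‖P u ^ q‖ ≤ 1 / 2 := by
  have hM0 : 0 ≤ M := (norm_nonneg _).trans (hM 0 (by simpa using hδ₀.le) 0)
  set π := ℓ.smulRight e with hπdef
  -- With `‖P u ^ k - π‖ ≤ 1 / (4 * D)`, the two errors made in replacing the outer factors `P u ^
  -- k` by `π` add up to at most `1/4`.
  set D := M * M + ‖π‖ * M + 1 with hD
  have hD0 : 0 < D := by positivity
  obtain ⟨k, hk, hk1⟩ := ((Metric.tendsto_nhds.1 hπ (1 / (4 * D)) (by positivity)).and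
    (eventually_ge_atTop 1)).exists
  have h1 : ∀ᶠ u in 𝓝 (0 : ℝ), dist (P u ^ k) π < 1 / (4 * D) := by
    have : Tendsto (fun u => dist (P u ^ k) π) (𝓝 0) (𝓝 _) :=
      ((hP.pow k).dist continuous_const).tendsto 0
    exact this.eventually_lt_const hk
  obtain ⟨δ₁, hδ₁, hball⟩ := Metric.eventually_nhds_iff.1 h1
  obtain ⟨A, δ₂, hδ₂, hA⟩ := hclt (1 / (4 * (‖ℓ‖ * ‖e‖ + 1))) (by positivity)
  -- The term `2 * k * δ₀ ^ 2` absorbs the `2 k` additional steps, because `u ^ 2 ≤ δ₀ ^ 2`.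
  refine ⟨min δ₀ (min (δ₁ / 2) δ₂), by positivity, A + 2 * k * δ₀ ^ 2, fun u hu0 hu => ?_⟩
  have hu1 : |u| ≤ δ₀ := hu.trans (min_le_left _ _)
  have hu2 : |u| ≤ δ₁ / 2 := hu.trans ((min_le_right _ _).trans (min_le_left _ _))
  have hu3 : |u| ≤ δ₂ := hu.trans ((min_le_right _ _).trans (min_le_right _ _))
  obtain ⟨n, hn, hnε⟩ := hA u hu0 hu3
  have hE : ‖P u ^ k - π‖ ≤ 1 / (4 * D) := by
    rw [← dist_eq_norm]
    exact (hball (by rw [Real.dist_eq, sub_zero]; linarith)).le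
  refine ⟨k + n + k, by omega, ?_, ?_⟩
  · have hu2' : u ^ 2 ≤ δ₀ ^ 2 := sq_le_sq' (abs_le.1 hu1).1 (abs_le.1 hu1).2
    have hupos : 0 < u ^ 2 := by positivity
    rw [add_div]
    push_cast
    have : 2 * (k : ℝ) ≤ 2 * k * δ₀ ^ 2 / u ^ 2 := by
      rw [le_div_iff₀ hupos]
      gcongr
    linarith
  · have e1 : P u ^ (k + n + k) = π * P u ^ n * π + ((P u ^ k - π) * (P u ^ n * P u ^ k) +
        π * (P u ^ n * (P u ^ k - π))) := by
      rw [pow_add, pow_add]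
      noncomm_ring
    have n1 : ‖π * P u ^ n * π‖ ≤ 1 / 4 := by
      refine ContinuousLinearMap.opNorm_le_bound _ (by norm_num) fun g => ?_
      have : (π * P u ^ n * π) g = (ℓ g * ℓ ((P u ^ n) e)) • e := by
        simp only [hπdef, mul_apply_eq_comp, ContinuousLinearMap.smulRight_apply, map_smul,
          smul_smul]
      rw [this, norm_smul, norm_mul]
      calc ‖ℓ g‖ * ‖ℓ ((P u ^ n) e)‖ * ‖e‖
          ≤ ‖ℓ‖ * ‖g‖ * (1 / (4 * (‖ℓ‖ * ‖e‖ + 1))) * ‖e‖ := by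
            gcongr
            exact ℓ.le_opNorm g
        _ = 1 / 4 * ‖g‖ * (‖ℓ‖ * ‖e‖ / (‖ℓ‖ * ‖e‖ + 1)) := by
            field_simp
        _ ≤ 1 / 4 * ‖g‖ * 1 := by
            gcongr
            rw [div_le_one (by positivity)]
            linarith
        _ = _ := mul_one _
    have n2 : ‖(P u ^ k - π) * (P u ^ n * P u ^ k)‖ ≤ 1 / (4 * D) * (M * M) := by
      refine (norm_mul_le _ _).trans ?_
      gcongr
      refine (norm_mul_le _ _).trans ?_
      gcongr <;> exact hM u hu1 _
    have n3 : ‖π * (P u ^ n * (P u ^ k - π))‖ ≤ ‖π‖ * (M * (1 / (4 * D))) := by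
      refine (norm_mul_le _ _).trans ?_
      gcongr
      refine (norm_mul_le _ _).trans ?_
      gcongr
      exact hM u hu1 _
    have n4 : 1 / (4 * D) * (M * M) + ‖π‖ * (M * (1 / (4 * D))) ≤ 1 / 4 := by
      have : 1 / (4 * D) * (M * M) + ‖π‖ * (M * (1 / (4 * D))) = (M * M + ‖π‖ * M) / (4 * D) := by
        field_simp
      rw [this, div_le_iff₀ (by positivity)]
      linarith
    rw [e1]
    have := norm_add_le (π * P u ^ n * π) ((P u ^ k - π) * (P u ^ n * P u ^ k) +
        π * (P u ^ n * (P u ^ k - π)))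
    have := norm_add_le ((P u ^ k - π) * (P u ^ n * P u ^ k)) (π * (P u ^ n * (P u ^ k - π)))
    linarith

/-- Away from `0`, spectral radii smaller than one give uniformly summable powers. -/
theorem exists_sum_norm_pow_le_of_isCompact [CompleteSpace B] {P : ℝ → B →L[ℂ] B}
    (hP : Continuous P) {K : Set ℝ} (hK : IsCompact K)
    (hρ : ∀ u ∈ K, spectralRadius ℂ (P u) < 1) :
    ∃ C, ∀ u ∈ K, ∀ n, ∑ j ∈ Finset.range n, ‖P u ^ j‖ ≤ C := by
  refine hK.induction_on (p := fun s => ∃ C, ∀ u ∈ s, ∀ n, ∑ j ∈ Finset.range n, ‖P u ^ j‖ ≤ C)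
    ⟨0, by simp⟩ (fun s t hst ⟨C, hC⟩ => ⟨C, fun u hu => hC u (hst hu)⟩) ?_ ?_
  · rintro s t ⟨C, hC⟩ ⟨C', hC'⟩
    refine ⟨max C C', fun u hu n => ?_⟩
    rcases hu with hu | hu
    · exact (hC u hu n).trans (le_max_left _ _)
    · exact (hC' u hu n).trans (le_max_right _ _)
  · intro u₀ hu₀
    -- A single power of norm below `1/2` is an open condition on the operator, which makes the
    -- bound locally uniform.
    obtain ⟨q, hq, hq1⟩ := (((tendsto_norm_pow_of_spectralRadius_lt_one
      (hρ u₀ hu₀)).eventually_lt_const (by norm_num : (0 : ℝ) < 1 / 2)).and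
      (eventually_ge_atTop 1)).exists
    have hc1 : Continuous fun u => ‖P u ^ q‖ := by fun_prop
    have hc2 : Continuous fun u => ∑ j ∈ Finset.range q, ‖P u ^ j‖ := by fun_prop
    have hev := ((hc1.tendsto u₀).eventually_lt_const hq).and
      ((hc2.tendsto u₀).eventually_lt_const (lt_add_one _))
    refine ⟨_, mem_nhdsWithin_of_mem_nhds hev,
      2 * (∑ j ∈ Finset.range q, ‖P u₀ ^ j‖ + 1) * q, fun u hu n => ?_⟩
    refine sum_norm_pow_le_of_norm_pow_le_half hq1 hu.1.le (fun j hj => ?_) n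
    exact (Finset.single_le_sum (f := fun j => ‖P u ^ j‖) (fun _ _ => norm_nonneg _)
      (Finset.mem_range.2 hj)).trans hu.2.le

/-- The diffusive bound for the sums of the norms of powers. -/
theorem exists_sum_norm_pow_le [CompleteSpace B] {P : ℝ → B →L[ℂ] B} (hP : Continuous P)
    (ℓ : B →L[ℂ] ℂ) (e : B)
    (hπ : Tendsto (fun k : ℕ => P 0 ^ k) atTop (𝓝 (ℓ.smulRight e))) {C : ℝ}
    (hC : ∀ u n g, ‖ℓ ((P u ^ n) g)‖ ≤ C * ‖g‖)
    (hclt : ∀ ε > (0 : ℝ), ∃ A : ℝ, ∃ δ > (0 : ℝ), ∀ u : ℝ, u ≠ 0 → |u| ≤ δ →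
      ∃ n : ℕ, n ≤ A / u ^ 2 ∧ ‖ℓ ((P u ^ n) e)‖ ≤ ε)
    (hρ : ∀ u, u ≠ 0 → spectralRadius ℂ (P u) < 1) (R : ℝ) :
    ∃ C', 0 ≤ C' ∧ ∀ n : ℕ, 1 ≤ n → ∀ u, |u| ≤ R →
      ∑ j ∈ Finset.range (n + 1), ‖P u ^ j‖ ≤ C' * n / (1 + √n * |u|) ^ 2 := by
  obtain ⟨δ₀, hδ₀, M, hM⟩ := exists_norm_pow_le hP ℓ e hπ hC
  have hM0 : 0 ≤ M := (norm_nonneg _).trans (hM 0 (by simpa using hδ₀.le) 0)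
  obtain ⟨δ₁, hδ₁, A, hA⟩ := exists_norm_pow_le_half hP ℓ e hπ hδ₀ hM hclt
  set δ := min δ₀ δ₁ with hδ
  have hδpos : 0 < δ := lt_min hδ₀ hδ₁
  set K : Set ℝ := {u | δ ≤ |u| ∧ |u| ≤ R} with hK
  have hKc : IsCompact K := by
    refine (isCompact_Icc (a := -R) (b := R)).of_isClosed_subset ?_ fun u hu => abs_le.1 hu.2
    exact (isClosed_le continuous_const continuous_abs).inter
      (isClosed_le continuous_abs continuous_const)
  obtain ⟨C₁, hC₁⟩ := exists_sum_norm_pow_le_of_isCompact hP hKc fun u hu =>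
    hρ u fun h0 => by simp [h0, hK] at hu; linarith
  set D := max (2 * M) (max (2 * M * A) (max C₁ (C₁ * R ^ 2))) with hD
  have hD0 : 0 ≤ D := (by positivity : 0 ≤ 2 * M).trans (le_max_left _ _)
  have hD2 : 2 * M * A ≤ D := (le_max_left _ _).trans (le_max_right _ _)
  have hD3 : C₁ ≤ D := (le_max_left _ _).trans ((le_max_right _ _).trans (le_max_right _ _))
  have hD4 : C₁ * R ^ 2 ≤ D :=
    (le_max_right _ _).trans ((le_max_right _ _).trans (le_max_right _ _))
  refine ⟨4 * D, by positivity, fun n hn u hu => ?_⟩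
  have hn' : (1 : ℝ) ≤ n := by exact_mod_cast hn
  set s := ∑ j ∈ Finset.range (n + 1), ‖P u ^ j‖ with hs
  have hs0 : 0 ≤ s := Finset.sum_nonneg fun _ _ => norm_nonneg _
  have hsn : s ≤ D * n := by
    by_cases huδ : |u| ≤ δ
    · have : s ≤ (n + 1) * M := by
        refine (Finset.sum_le_sum fun j _ => hM u (huδ.trans (min_le_left _ _)) j).trans ?_
        simp
      have h2 : 2 * M * n ≤ D * n := by gcongr; exact le_max_left _ _
      nlinarith
    · have h1 := hC₁ u ⟨(not_le.1 huδ).le, hu⟩ (n + 1)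
      nlinarith
  -- This and `hsn` are the two regimes of `min(n, u⁻²)`; they are merged at the end by `(1 + x) ^ 2
  -- ≤ 2 + 2 x ^ 2` with `x = √n |u|`.
  have hsu : s * u ^ 2 ≤ D := by
    rcases eq_or_ne u 0 with rfl | hu0
    · simpa using hD0
    have hupos : 0 < u ^ 2 := by positivity
    by_cases huδ : |u| ≤ δ
    · obtain ⟨q, hq1, hq, hhalf⟩ := hA u hu0 (huδ.trans (min_le_right _ _))
      have h1 := sum_norm_pow_le_of_norm_pow_le_half hq1 hhalf
        (fun j _ => hM u (huδ.trans (min_le_left _ _)) j) (n + 1)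
      rw [le_div_iff₀ hupos] at hq
      calc s * u ^ 2 ≤ 2 * M * q * u ^ 2 := by gcongr
        _ = 2 * M * (q * u ^ 2) := by ring
        _ ≤ 2 * M * A := by gcongr
        _ ≤ D := hD2
    · have h1 := hC₁ u ⟨(not_le.1 huδ).le, hu⟩ (n + 1)
      have h2 : u ^ 2 ≤ R ^ 2 := sq_le_sq' (abs_le.1 hu).1 (abs_le.1 hu).2
      have h3 : 0 ≤ C₁ := hs0.trans h1
      calc s * u ^ 2 ≤ C₁ * R ^ 2 := by gcongr
        _ ≤ D := hD4
  have hpos : 0 < (1 + √(n : ℝ) * |u|) ^ 2 := by positivity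
  rw [le_div_iff₀ hpos]
  have e1 : (√(n : ℝ) * |u|) ^ 2 = n * u ^ 2 := by
    rw [mul_pow, Real.sq_sqrt (by positivity), sq_abs]
  have e2 : (1 + √(n : ℝ) * |u|) ^ 2 ≤ 2 + 2 * (n * u ^ 2) := by
    rw [← e1]
    nlinarith [sq_nonneg (1 - √(n : ℝ) * |u|)]
  calc s * (1 + √(n : ℝ) * |u|) ^ 2 ≤ s * (2 + 2 * (n * u ^ 2)) := by gcongr
    _ = 2 * s + 2 * n * (s * u ^ 2) := by ring
    _ ≤ 2 * (D * n) + 2 * n * D := by gcongr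
    _ = 4 * D * n := by ring

end Powers

/-! ### Duality between the operators and the partial sums -/

section Duality

theorem measurable_birkhoffSum {X : Type*} [MeasurableSpace X] {T : X → X} (hT : Measurable T)
    {φ : X → ℝ} (hφ : Measurable φ) (n : ℕ) : Measurable (birkhoffSum T φ n) := by
  unfold birkhoffSum
  exact Finset.measurable_sum _ fun k _ => hφ.comp (hT.iterate k)

theorem birkhoffSum_add_apply {X : Type*} (T : X → X) (φ : X → ℝ) (k l : ℕ) (x : X) :
    birkhoffSum T φ (k + l) x = birkhoffSum T φ k x + birkhoffSum T φ l (T^[k] x) := by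
  simp [birkhoffSum, Finset.sum_range_add, ← Function.iterate_add_apply, add_comm]

theorem norm_exp_I_mul_ofReal_mul_ofReal (u s : ℝ) :
    ‖Complex.exp (Complex.I * u * s)‖ = 1 := by
  rw [mul_assoc, mul_comm, ← Complex.ofReal_mul, Complex.norm_exp_ofReal_mul_I]

theorem ae_norm_le_norm_Lp_top {X : Type*} [MeasurableSpace X] {m : Measure X} (g : Lp ℂ ∞ m) :
    ∀ᵐ x ∂m, ‖g x‖ ≤ ‖g‖ := by
  filter_upwards [ae_le_eLpNormEssSup (f := g) (μ := m)] with x hx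
  rwa [← eLpNorm_exponent_top, ← Lp.enorm_def, enorm_le_iff_norm_le] at hx

variable {X : Type*} [MeasurableSpace X] {m : Measure X} [IsProbabilityMeasure m]

/-- The transfer operator only depends on the almost everywhere class. -/
theorem isTransfer_of_ae_eq {T : X → X} (hT : MeasurePreserving T m m) {f g : X → ℂ}
    (hf : Integrable f m) (hg : g =ᵐ[m] transferOperator m T f) : IsTransfer m T f g := by
  obtain ⟨h1, h2⟩ := isTransfer_transferOperator hT hf
  refine ⟨h1.congr hg.symm, fun h hh hb => (h2 h hh hb).trans (integral_congr_ae ?_)⟩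
  filter_upwards [hg] with x hx
  rw [hx]

variable {B : Type*} [NormedAddCommGroup B] [NormedSpace ℂ B]

theorem integrable_coeFn_Lp_top (g : Lp ℂ ∞ m) : Integrable g m :=
  (Lp.memLp g).integrable le_top

/-- Integration against a bounded function is a continuous linear functional. -/
theorem exists_clm_eq_integral_mul (ι : B →L[ℂ] Lp ℂ ∞ m) {h : X → ℂ} (hh : Measurable h) {C : ℝ}
    (hC : ∀ x, ‖h x‖ ≤ C) : ∃ ℓ : B →L[ℂ] ℂ, ∀ b, ℓ b = ∫ x, ι b x * h x ∂m := by
  have hi : ∀ b, Integrable (fun x => ι b x * h x) m := fun b =>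
    (integrable_coeFn_Lp_top (ι b)).mul_bdd (c := C) hh.aestronglyMeasurable
      (Eventually.of_forall hC)
  refine ⟨LinearMap.mkContinuous
    { toFun := fun b => ∫ x, ι b x * h x ∂m
      map_add' := fun a b => ?_
      map_smul' := fun c b => ?_ } (‖ι‖ * C) fun b => ?_, fun b => rfl⟩
  · rw [← integral_add (hi a) (hi b)]
    refine integral_congr_ae ?_
    rw [map_add]
    filter_upwards [Lp.coeFn_add (ι a) (ι b)] with x hx
    rw [hx, Pi.add_apply, add_mul]
  · rw [RingHom.id_apply, ← integral_smul]
    refine integral_congr_ae ?_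
    rw [map_smul]
    filter_upwards [Lp.coeFn_smul c (ι b)] with x hx
    rw [hx, Pi.smul_apply, smul_eq_mul, smul_eq_mul, mul_assoc]
  · have hb : ∀ᵐ x ∂m, ‖ι b x * h x‖ ≤ ‖ι‖ * C * ‖b‖ := by
      filter_upwards [ae_norm_le_norm_Lp_top (ι b)] with x hx
      rw [norm_mul]
      calc ‖ι b x‖ * ‖h x‖ ≤ (‖ι‖ * ‖b‖) * C :=
            mul_le_mul (hx.trans (ι.le_opNorm b)) (hC x) (norm_nonneg _) (by positivity)
        _ = _ := by ring
    simpa using norm_integral_le_of_norm_le_const hb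

variable {T : X → X} {φ : X → ℝ} {ι : B →L[ℂ] Lp ℂ ∞ m} {P : ℝ → (B →L[ℂ] B)}

/-- The powers of the characteristic function operators encode the partial sums. -/
theorem integral_pow_apply_mul (hT : MeasurePreserving T m m) (hφ : Measurable φ)
    (hP : ∀ (t : ℝ) (b : B), ι (P t b) =ᵐ[m] charFunOperator m T φ t (ι b))
    (u : ℝ) (k : ℕ) (g : B) {h : X → ℂ} (hh : Measurable h) {C : ℝ} (hC : ∀ x, ‖h x‖ ≤ C) :
    ∫ x, ι ((P u ^ k) g) x * h x ∂m =
      ∫ x, ι g x * (Complex.exp (Complex.I * u * birkhoffSum T φ k x) * h (T^[k] x)) ∂m := by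
  induction k generalizing g with
  | zero => simp
  | succ k ih =>
    rw [pow_succ, mul_apply_eq_comp, ih]
    have hexp : Measurable fun x => Complex.exp (Complex.I * u * φ x) := by fun_prop
    have hi : Integrable (fun x => Complex.exp (Complex.I * u * φ x) * ι g x) m :=
      (integrable_coeFn_Lp_top (ι g)).bdd_mul (c := 1) hexp.aestronglyMeasurable
        (Eventually.of_forall fun x => (norm_exp_I_mul_ofReal_mul_ofReal u (φ x)).le)
    have hS := measurable_birkhoffSum hT.measurable hφ k
    have hTk : Measurable T^[k] := hT.measurable.iterate k
    rw [← (isTransfer_of_ae_eq hT hi (hP u g)).2 (fun x =>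
      Complex.exp (Complex.I * u * birkhoffSum T φ k x) * h (T^[k] x)) (by fun_prop)
      ⟨C, fun x => by rw [norm_mul, norm_exp_I_mul_ofReal_mul_ofReal, one_mul]; exact hC _⟩]
    congr 1 with x
    rw [birkhoffSum_succ', Function.iterate_succ_apply]
    push_cast
    rw [mul_add, Complex.exp_add]
    ring

/-- Under a spectral gap, the powers of the transfer operator converge to the expectation. -/
theorem tendsto_pow_transfer [CompleteSpace B] (hT : MeasurePreserving T m m)
    (hφ : Measurable φ) (hι : Function.Injective ι) {e : B} (h_one : ι e =ᵐ[m] fun _ => (1 : ℂ))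
    (hP : ∀ (t : ℝ) (b : B), ι (P t b) =ᵐ[m] charFunOperator m T φ t (ι b))
    {N : B →L[ℂ] B} (hN : ∀ b : B, P 0 b = (∫ x, ι b x ∂m) • e + N b)
    (hN_radius : spectralRadius ℂ N < 1) {ℓ : B →L[ℂ] ℂ} (hℓ : ∀ b, ℓ b = ∫ x, ι b x ∂m) :
    Tendsto (fun k : ℕ => P 0 ^ k) atTop (𝓝 (ℓ.smulRight e)) := by
  have hdual : ∀ (k : ℕ) (b : B), ℓ ((P 0 ^ k) b) = ℓ b := by
    intro k b
    have := integral_pow_apply_mul hT hφ hP 0 k b (h := fun _ => 1) measurable_const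
      (C := 1) (by simp)
    simpa [hℓ] using this
  -- Invariance of `m` under `T` makes the constant `1` a fixed point of the transfer operator.
  have hPe : P 0 e = e := by
    refine hι (Lp.ext ?_)
    have hi : Integrable (fun x => Complex.exp (Complex.I * (0 : ℝ) * φ x) * ι e x) m := by
      simpa using integrable_coeFn_Lp_top (ι e)
    refine (isTransfer_of_ae_eq hT hi (hP 0 e)).ae_eq ⟨integrable_coeFn_Lp_top (ι e), ?_⟩
    intro h hh _
    have e1 : ∫ x, Complex.exp (Complex.I * (0 : ℝ) * φ x) * ι e x * h (T x) ∂m =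
        ∫ x, h (T x) ∂m := by
      refine integral_congr_ae ?_
      filter_upwards [h_one] with x hx
      simp [hx]
    have e2 : ∫ x, ι e x * h x ∂m = ∫ x, h x ∂m := by
      refine integral_congr_ae ?_
      filter_upwards [h_one] with x hx
      simp [hx]
    rw [e1, e2]
    have h3 := integral_map (μ := m) (φ := T) hT.measurable.aemeasurable (f := h)
      hh.aestronglyMeasurable
    rw [hT.map_eq] at h3
    exact h3.symm
  have hℓe : ℓ e = 1 := by
    rw [hℓ, integral_congr_ae h_one]
    simp
  have hNe : N e = 0 := by
    have := hN e
    rw [hPe, ← hℓ, hℓe, one_smul] at this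
    simpa using this
  -- Since `N e = 0` and `ℓ` is invariant under `P 0`, the mixed terms vanish. The exponent starts
  -- at one because the identity fails at exponent zero.
  have hpow : ∀ k : ℕ, P 0 ^ (k + 1) = ℓ.smulRight e + N ^ (k + 1) := by
    intro k
    induction k with
    | zero =>
      ext b
      simp [hN, hℓ]
    | succ k ih =>
      ext b
      have e1 : (P 0 ^ (k + 1 + 1)) b = P 0 ((P 0 ^ (k + 1)) b) := by
        rw [pow_succ' (P 0) (k + 1), mul_apply_eq_comp]
      rw [e1, hN, ← hℓ, hdual, ih, pow_succ' N (k + 1)]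
      simp [hNe]
  rw [← tendsto_add_atTop_iff_nat 1, tendsto_iff_norm_sub_tendsto_zero]
  have h0 := (tendsto_add_atTop_iff_nat 1).2 (tendsto_norm_pow_of_spectralRadius_lt_one hN_radius)
  refine h0.congr fun k => ?_
  rw [hpow, add_sub_cancel_left]

end Duality

/-! ### The central limit theorem on the parabolic scale -/

section CentralLimit

/-- A change of sign of `u` conjugates the integral. This reduces the two-sided statement below to
the limit `u → 0+`. -/
theorem norm_integral_exp_abs {X : Type*} [MeasurableSpace X] {m : Measure X} (S : X → ℝ) (u : ℝ) :
    ‖∫ x, Complex.exp (Complex.I * u * S x) ∂m‖ =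
      ‖∫ x, Complex.exp (Complex.I * |u| * S x) ∂m‖ := by
  rcases abs_cases u with ⟨h, -⟩ | ⟨h, -⟩
  · rw [h]
  · rw [h, ← Complex.norm_conj, ← integral_conj]
    congr 2 with x
    rw [← Complex.exp_conj]
    simp

variable {X : Type*} [MeasurableSpace X] {m : Measure X} [IsProbabilityMeasure m]

/-- A central limit theorem makes `E exp (i u S_n)` small for some `n` of order `u⁻²`. -/
theorem exists_norm_integral_exp_le {Ω : Type*} [MeasurableSpace Ω] {Q : Measure Ω}
    [IsProbabilityMeasure Q] {S : ℕ → X → ℝ} {Z : Ω → ℝ}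
    (h : TendstoInDistribution (fun (n : ℕ) x => (√(n : ℝ))⁻¹ * S n x) atTop Z (fun _ => m) Q)
    {v : ℝ≥0} (hv : 0 < v) (hZ : Q.map Z = gaussianReal 0 v) {ε : ℝ} (hε : 0 < ε) :
    ∃ A : ℝ, ∃ δ > (0 : ℝ), ∀ u : ℝ, u ≠ 0 → |u| ≤ δ →
      ∃ n : ℕ, n ≤ A / u ^ 2 ∧ ‖∫ x, Complex.exp (Complex.I * u * S n x) ∂m‖ ≤ ε := by
  have hv' : (0 : ℝ) < v := hv
  obtain ⟨t, ht, htε⟩ : ∃ t : ℝ, 0 < t ∧ Real.exp (-(v * t ^ 2 / 2)) < ε := by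
    have h1 : Tendsto (fun t : ℝ => Real.exp (-(v * t ^ 2 / 2))) atTop (𝓝 0) := by
      refine Real.tendsto_exp_atBot.comp (tendsto_neg_atTop_atBot.comp ?_)
      exact ((tendsto_pow_atTop two_ne_zero).const_mul_atTop hv').atTop_div_const two_pos
    obtain ⟨t, ht1, ht2⟩ := ((h1.eventually_lt_const hε).and (eventually_gt_atTop 0)).exists
    exact ⟨t, ht2, ht1⟩
  -- With this time scale `u √(n u)` tends to `t`, so `u S_{n u}` converges in law to `t Z` by
  -- Slutsky's theorem; `t` was taken so large that the Gaussian characteristic function at `t` is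
  -- below `ε`.
  let n : ℝ → ℕ := fun u : ℝ => ⌊t ^ 2 / u ^ 2⌋₊
  have hsq : Tendsto (fun u : ℝ => t ^ 2 / u ^ 2) (𝓝[>] 0) atTop := by
    have h1 : Tendsto (fun u : ℝ => u ^ 2) (𝓝[>] 0) (𝓝[>] 0) := by
      refine tendsto_nhdsWithin_iff.2 ⟨?_, ?_⟩
      · have : Tendsto (fun u : ℝ => u ^ 2) (𝓝 0) (𝓝 (0 ^ 2)) := (continuous_pow 2).tendsto 0
        simpa using this.mono_left nhdsWithin_le_nhds
      · filter_upwards [self_mem_nhdsWithin] with u hu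
        exact pow_pos (Set.mem_Ioi.1 hu) 2
    simpa [div_eq_mul_inv] using (h1.inv_tendsto_nhdsGT_zero).const_mul_atTop (pow_pos ht 2)
  have hnt : Tendsto n (𝓝[>] 0) atTop := tendsto_nat_floor_atTop.comp hsq
  have hc : Tendsto (fun u : ℝ => u * √(n u : ℝ)) (𝓝[>] 0) (𝓝 t) := by
    have h1 : Tendsto (fun u : ℝ => (n u : ℝ) / (t ^ 2 / u ^ 2)) (𝓝[>] 0) (𝓝 1) :=
      (tendsto_nat_floor_div_atTop (R := ℝ)).comp hsq
    have h2 : Tendsto (fun u : ℝ => t * √((n u : ℝ) / (t ^ 2 / u ^ 2))) (𝓝[>] 0)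
        (𝓝 (t * √1)) := (h1.sqrt).const_mul t
    rw [Real.sqrt_one, mul_one] at h2
    refine h2.congr' ?_
    filter_upwards [self_mem_nhdsWithin] with u hu
    have hu : 0 < u := hu
    have e1 : (n u : ℝ) / (t ^ 2 / u ^ 2) = (n u : ℝ) * (u / t) ^ 2 := by
      field_simp
    rw [e1, Real.sqrt_mul (by positivity), Real.sqrt_sq (by positivity)]
    field_simp
  have h1 : TendstoInDistribution (fun (u : ℝ) x => (√(n u : ℝ))⁻¹ * S (n u) x) (𝓝[>] 0) Z
      (fun _ => m) Q :=
    ⟨fun u => h.forall_aemeasurable (n u), h.aemeasurable_limit, h.tendsto.comp hnt⟩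
  have h2 : TendstoInMeasure m (fun (u : ℝ) (_ : X) => u * √(n u : ℝ)) (𝓝[>] 0)
      (fun _ => t) := by
    rw [tendstoInMeasure_iff_dist]
    intro η hη
    refine tendsto_const_nhds.congr' ?_
    filter_upwards [Metric.tendsto_nhds.1 hc η hη] with u hu
    simp [not_le.2 hu]
  have h3 := h1.continuous_comp_prodMk_of_tendstoInMeasure_const
    (g := fun p : ℝ × ℝ => p.2 * p.1) (by fun_prop) h2 fun _ => by fun_prop
  have h4 := (ProbabilityMeasure.tendsto_iff_forall_integral_rclike_tendsto ℂ).1 h3.tendsto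
    (BoundedContinuousFunction.innerProbChar 1)
  simp only [ProbabilityMeasure.coe_mk, ← charFun_eq_integral_innerProbChar] at h4
  have e1 : charFun (Q.map fun w => t * Z w) 1 = charFun (gaussianReal 0 v) t := by
    rw [← hZ, charFun_apply_real, charFun_apply_real,
      integral_map (h.aemeasurable_limit.const_mul t) (by fun_prop),
      integral_map h.aemeasurable_limit (by fun_prop)]
    simp
  have e2 : ‖charFun (gaussianReal 0 v) t‖ = Real.exp (-(v * t ^ 2 / 2)) := by
    have e3 : (t : ℂ) * ((0 : ℝ) : ℂ) * Complex.I - (v : ℝ) * t ^ 2 / 2 =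
        ((-(v * t ^ 2 / 2) : ℝ) : ℂ) := by
      push_cast
      ring
    rw [charFun_gaussianReal, Complex.norm_exp, e3, Complex.ofReal_re]
  have h5 := h4.norm
  rw [e1, e2] at h5
  obtain ⟨δ, hδ, hball⟩ := Metric.mem_nhdsWithin_iff.1
    ((h5.eventually_lt_const htε).and (hnt.eventually_ge_atTop 1))
  refine ⟨t ^ 2, δ / 2, by positivity, fun u hu0 hu => ⟨n |u|, ?_, ?_⟩⟩
  · rw [← sq_abs u]
    exact Nat.floor_le (by positivity)
  · have hupos : 0 < |u| := abs_pos.2 hu0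
    obtain ⟨h6, h0⟩ := hball
      ⟨by rw [Metric.mem_ball, Real.dist_eq, sub_zero, abs_abs]; linarith, hupos⟩
    have h6 : ‖charFun (m.map fun x => |u| * √(n |u| : ℝ) * ((√(n |u| : ℝ))⁻¹ * S (n |u|) x)) 1‖
      < ε := h6
    rw [norm_integral_exp_abs]
    refine le_of_eq_of_le ?_ h6.le
    rw [charFun_apply_real, integral_map ((h.forall_aemeasurable _).const_mul _) (by fun_prop)]
    have h7 : √(n |u| : ℝ) ≠ 0 := by
      have : (1 : ℝ) ≤ n |u| := by exact_mod_cast h0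
      positivity
    congr 2 with x
    rw [mul_assoc |u|, mul_inv_cancel_left₀ h7]
    push_cast
    ring_nf

end CentralLimit

/-! ### Complete homogeneous sums -/

section CompleteSum

/-- The sum of the products `a l₀ * ⋯ * a lⱼ` over `l₀ ≤ ⋯ ≤ lⱼ = k`. -/
def completeSum {R : Type*} [CommSemiring R] (a : ℕ → R) : ℕ → ℕ → R
  | 0, k => a k
  | j + 1, k => a k * ∑ l ∈ Finset.range (k + 1), completeSum a j l

theorem ofReal_completeSum (a : ℕ → ℝ) (j k : ℕ) :
    ((completeSum a j k : ℝ) : ℂ) = completeSum (fun l => (a l : ℂ)) j k := by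
  induction j generalizing k with
  | zero => rfl
  | succ j ih => simp [completeSum, ih]

/-- Newton's identities for the complete homogeneous sums up to degree four. -/
theorem newton_completeSum (a : ℕ → ℝ) (n : ℕ) :
    2 * ∑ k ∈ Finset.range n, completeSum a 1 k =
      (∑ k ∈ Finset.range n, a k) ^ 2 + ∑ k ∈ Finset.range n, a k ^ 2 ∧
    6 * ∑ k ∈ Finset.range n, completeSum a 2 k =
      (∑ k ∈ Finset.range n, a k) ^ 3 +
      3 * (∑ k ∈ Finset.range n, a k) * ∑ k ∈ Finset.range n, a k ^ 2 +
      2 * ∑ k ∈ Finset.range n, a k ^ 3 ∧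
    24 * ∑ k ∈ Finset.range n, completeSum a 3 k =
      (∑ k ∈ Finset.range n, a k) ^ 4 +
      6 * (∑ k ∈ Finset.range n, a k) ^ 2 * ∑ k ∈ Finset.range n, a k ^ 2 +
      3 * (∑ k ∈ Finset.range n, a k ^ 2) ^ 2 +
      8 * (∑ k ∈ Finset.range n, a k) * ∑ k ∈ Finset.range n, a k ^ 3 +
      6 * ∑ k ∈ Finset.range n, a k ^ 4 := by
  have h1 : ∀ n, ∑ k ∈ Finset.range n, completeSum a 0 k = ∑ k ∈ Finset.range n, a k :=
    fun n => rfl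
  -- This is `h_{d+1}(a₀,…,aₙ) = h_{d+1}(a₀,…,aₙ₋₁) + aₙ h_d(a₀,…,aₙ)`. The index `j` of
  -- `completeSum` corresponds to degree `j + 1`.
  have hs : ∀ j n, ∑ k ∈ Finset.range (n + 1), completeSum a (j + 1) k =
      ∑ k ∈ Finset.range n, completeSum a (j + 1) k +
        a n * ∑ k ∈ Finset.range (n + 1), completeSum a j k := by
    intro j n
    rw [Finset.sum_range_succ]
    rfl
  have key2 : ∀ n, 2 * ∑ k ∈ Finset.range n, completeSum a 1 k =
      (∑ k ∈ Finset.range n, a k) ^ 2 + ∑ k ∈ Finset.range n, a k ^ 2 := by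
    intro n
    induction n with
    | zero => simp
    | succ n ih =>
      rw [hs 0, h1, Finset.sum_range_succ a, Finset.sum_range_succ fun k => a k ^ 2]
      linear_combination ih
  have key3 : ∀ n, 6 * ∑ k ∈ Finset.range n, completeSum a 2 k =
      (∑ k ∈ Finset.range n, a k) ^ 3 +
      3 * (∑ k ∈ Finset.range n, a k) * ∑ k ∈ Finset.range n, a k ^ 2 +
      2 * ∑ k ∈ Finset.range n, a k ^ 3 := by
    intro n
    induction n with
    | zero => simp
    | succ n ih =>
      have h2 := key2 (n + 1)
      rw [hs 1]
      rw [Finset.sum_range_succ a, Finset.sum_range_succ fun k => a k ^ 2] at h2 ⊢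
      rw [Finset.sum_range_succ fun k => a k ^ 3]
      linear_combination ih + 3 * a n * h2
  refine ⟨key2 n, key3 n, ?_⟩
  induction n with
  | zero => simp
  | succ n ih =>
    have h3 := key3 (n + 1)
    rw [hs 2]
    rw [Finset.sum_range_succ a, Finset.sum_range_succ fun k => a k ^ 2,
      Finset.sum_range_succ fun k => a k ^ 3] at h3 ⊢
    rw [Finset.sum_range_succ fun k => a k ^ 4]
    linear_combination ih + 4 * a n * h3

/-- The fourth power of a sum of real numbers is dominated by the complete homogeneous sum. -/
theorem sum_pow_four_le_completeSum (a : ℕ → ℝ) (n : ℕ) :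
    (∑ k ∈ Finset.range n, a k) ^ 4 ≤ 24 * ∑ k ∈ Finset.range n, completeSum a 3 k := by
  rw [(newton_completeSum a n).2.2]
  set p := ∑ k ∈ Finset.range n, a k
  -- Only the cubic term `8 p ∑ aₖ³` in Newton's identity can be negative; this sum of squares
  -- absorbs it. Ordered products with repetitions therefore suffice, and coinciding times need no
  -- separate treatment.
  have h : 0 ≤ ∑ k ∈ Finset.range n, (4 * (p * a k + a k ^ 2) ^ 2) :=
    Finset.sum_nonneg fun k _ => by positivity
  have e : ∑ k ∈ Finset.range n, (4 * (p * a k + a k ^ 2) ^ 2) =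
      4 * p ^ 2 * ∑ k ∈ Finset.range n, a k ^ 2 + 8 * p * ∑ k ∈ Finset.range n, a k ^ 3 +
        4 * ∑ k ∈ Finset.range n, a k ^ 4 := by
    simp only [Finset.mul_sum, ← Finset.sum_add_distrib]
    exact Finset.sum_congr rfl fun k _ => by ring
  have h2 : 0 ≤ ∑ k ∈ Finset.range n, a k ^ 2 := Finset.sum_nonneg fun k _ => sq_nonneg _
  have h4 : 0 ≤ ∑ k ∈ Finset.range n, a k ^ 4 := Finset.sum_nonneg fun k _ => by positivity
  have h5 : 0 ≤ p ^ 2 * ∑ k ∈ Finset.range n, a k ^ 2 := by positivity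
  nlinarith [sq_nonneg (∑ k ∈ Finset.range n, a k ^ 2)]

/-- Young's inequality for truncated convolutions of nonnegative sequences. -/
theorem sum_convolution_le {p β : ℕ → ℝ} (hp : ∀ k, 0 ≤ p k) (hβ : ∀ k, 0 ≤ β k) (n : ℕ) :
    ∑ k ∈ Finset.range n, ∑ l ∈ Finset.range (k + 1), p (k - l) * β l ≤
      (∑ k ∈ Finset.range n, p k) * ∑ k ∈ Finset.range n, β k := by
  rw [Finset.sum_range_diag_flip n fun l d => p d * β l, mul_comm, Finset.sum_mul]
  refine Finset.sum_le_sum fun l _ => ?_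
  rw [← Finset.sum_mul, mul_comm]
  refine mul_le_mul_of_nonneg_left (Finset.sum_le_sum_of_subset_of_nonneg ?_ fun k _ _ => hp k)
    (hβ l)
  exact Finset.range_mono (Nat.sub_le n l)

end CompleteSum

/-! ### Encoding functionals of the partial sums by elements of the Banach space -/

section Encodes

variable {X : Type*} [MeasurableSpace X]
variable {B : Type*} [NormedAddCommGroup B] [NormedSpace ℂ B]

/-- `b η` is the image of `exp (i η S_k) u` under the `k`-th power of the transfer operator. -/
def Encodes (m : Measure X) (T : X → X) (φ : X → ℝ) (ι : B →L[ℂ] Lp ℂ ∞ m) (k : ℕ) (u : X → ℂ)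
    (b : ℝ → B) : Prop :=
  Measurable u ∧ (∃ C : ℝ, ∀ x, ‖u x‖ ≤ C) ∧ Continuous b ∧
    ∀ (η : ℝ) (h : X → ℂ), Measurable h → (∃ C : ℝ, ∀ x, ‖h x‖ ≤ C) →
      ∫ x, ι (b η) x * h x ∂m =
        ∫ x, u x * (Complex.exp (Complex.I * η * birkhoffSum T φ k x) * h (T^[k] x)) ∂m

theorem encodes_one {m : Measure X} {T : X → X} {φ : X → ℝ}
    {ι : B →L[ℂ] Lp ℂ ∞ m} {e : B} (h_one : ι e =ᵐ[m] fun _ => (1 : ℂ)) :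
    Encodes m T φ ι 0 (fun _ => 1) (fun _ => e) := by
  refine ⟨measurable_const, ⟨1, by simp⟩, continuous_const, fun η h _ _ => ?_⟩
  refine integral_congr_ae ?_
  filter_upwards [h_one] with x hx
  simp [hx]

variable {m : Measure X} [IsProbabilityMeasure m] {T : X → X} {φ : X → ℝ}
  {ι : B →L[ℂ] Lp ℂ ∞ m} {P : ℝ → (B →L[ℂ] B)}

/-- By the cocycle identity `S_{k+d} = S_k + S_d ∘ T^k`, letting `d` further steps pass at frequency
`η` amounts to applying `P η ^ d`. -/
theorem Encodes.pow (hT : MeasurePreserving T m m) (hφ : Measurable φ)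
    (hP : ∀ (t : ℝ) (b : B), ι (P t b) =ᵐ[m] charFunOperator m T φ t (ι b)) (hPc : Continuous P)
    {k : ℕ} {u : X → ℂ} {b : ℝ → B} (hb : Encodes m T φ ι k u b) (d : ℕ) :
    Encodes m T φ ι (k + d) u (fun η => (P η ^ d) (b η)) := by
  obtain ⟨hu, hub, hbc, hdual⟩ := hb
  refine ⟨hu, hub, (hPc.pow d).clm_apply hbc, fun η h hh ⟨C, hC⟩ => ?_⟩
  have hS := measurable_birkhoffSum hT.measurable hφ d
  have hTd : Measurable T^[d] := hT.measurable.iterate d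
  rw [integral_pow_apply_mul hT hφ hP η d (b η) hh hC,
    hdual η (fun x => Complex.exp (Complex.I * η * birkhoffSum T φ d x) * h (T^[d] x))
      (by fun_prop)
      ⟨C, fun x => by rw [norm_mul, norm_exp_I_mul_ofReal_mul_ofReal, one_mul]; exact hC _⟩]
  congr 1 with x
  rw [birkhoffSum_add_apply, ← Function.iterate_add_apply, add_comm d k]
  push_cast
  rw [mul_add, Complex.exp_add]
  ring

theorem Encodes.sum (hT : MeasurePreserving T m m) (hφ : Measurable φ) {k : ℕ} {s : Finset ℕ}
    {u : ℕ → X → ℂ} {b : ℕ → ℝ → B} (hb : ∀ l ∈ s, Encodes m T φ ι k (u l) (b l)) :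
    Encodes m T φ ι k (fun x => ∑ l ∈ s, u l x) (fun η => ∑ l ∈ s, b l η) := by
  have hS := measurable_birkhoffSum hT.measurable hφ k
  have hTk : Measurable T^[k] := hT.measurable.iterate k
  refine ⟨Finset.measurable_sum _ fun l hl => (hb l hl).1, ?_,
    continuous_finsetSum _ fun l hl => (hb l hl).2.2.1, fun η h hh ⟨C, hC⟩ => ?_⟩
  · choose! C hC using fun l hl => (hb l hl).2.1
    exact ⟨∑ l ∈ s, C l, fun x => (norm_sum_le _ _).trans (Finset.sum_le_sum fun l hl => hC l hl x)⟩
  · obtain ⟨ℓ, hℓ⟩ := exists_clm_eq_integral_mul ι hh hC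
    rw [← hℓ, map_sum]
    simp_rw [Finset.sum_mul]
    rw [integral_finsetSum]
    · exact Finset.sum_congr rfl fun l hl => by rw [hℓ, (hb l hl).2.2.2 η h hh ⟨C, hC⟩]
    · intro l hl
      obtain ⟨hu, ⟨C', hC'⟩, -⟩ := hb l hl
      refine Integrable.of_bound (C := C' * C) (by fun_prop) (Eventually.of_forall fun x => ?_)
      rw [norm_mul, norm_mul, norm_exp_I_mul_ofReal_mul_ofReal, one_mul]
      exact mul_le_mul (hC' x) (hC _) (norm_nonneg _) ((norm_nonneg _).trans (hC' x))

/-- The new factor is a superposition of the characters `exp(iξ S_k)`, and each of them shifts the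
frequency from `η` to `ξ + η`. The rest is Fubini's theorem, available because `ψ` is integrable and
all other factors are bounded. -/
theorem Encodes.mul_fourier [CompleteSpace B] (hT : MeasurePreserving T m m) (hφ : Measurable φ)
    {k : ℕ} {u : X → ℂ} {b : ℝ → B} (hb : Encodes m T φ ι k u b) {ψ : ℝ → ℂ}
    (hψ : Continuous ψ) (hψs : HasCompactSupport ψ) :
    Encodes m T φ ι k
      (fun x => (∫ ξ, ψ ξ * Complex.exp (Complex.I * ξ * birkhoffSum T φ k x)) * u x)
      (fun η => ∫ ξ, ψ ξ • b (ξ + η)) := by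
  obtain ⟨hu, ⟨C, hC⟩, hbc, hdual⟩ := hb
  have hS := measurable_birkhoffSum hT.measurable hφ k
  have hTk : Measurable T^[k] := hT.measurable.iterate k
  have hψi : Integrable ψ := hψ.integrable_of_hasCompactSupport hψs
  have hFm : Measurable fun s : ℝ => ∫ ξ : ℝ, ψ ξ * Complex.exp (Complex.I * ξ * s) := by
    have : StronglyMeasurable fun p : ℝ × ℝ => ψ p.2 * Complex.exp (Complex.I * p.2 * p.1) :=
      (by fun_prop : Continuous fun p : ℝ × ℝ =>
        ψ p.2 * Complex.exp (Complex.I * p.2 * p.1)).stronglyMeasurable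
    exact this.integral_prod_right.measurable
  refine ⟨(hFm.comp hS).mul hu, ⟨(∫ ξ, ‖ψ ξ‖) * C, fun x => ?_⟩, ?_, fun η h hh ⟨C', hC'⟩ => ?_⟩
  · rw [norm_mul]
    refine mul_le_mul ((norm_integral_le_integral_norm _).trans (le_of_eq ?_)) (hC x)
      (norm_nonneg _) (integral_nonneg fun _ => norm_nonneg _)
    congr 1 with ξ
    rw [norm_mul, norm_exp_I_mul_ofReal_mul_ofReal, mul_one]
  · rw [← continuousOn_univ]
    refine continuousOn_integral_of_compact_support (k := tsupport ψ) hψs ?_ fun p ξ _ hξ => ?_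
    · exact (by fun_prop : Continuous (Function.uncurry fun η ξ => ψ ξ • b (ξ + η))).continuousOn
    · rw [image_eq_zero_of_notMem_tsupport hξ, zero_smul]
  · obtain ⟨ℓ, hℓ⟩ := exists_clm_eq_integral_mul ι hh hC'
    have hbi : Integrable fun ξ => ψ ξ • b (ξ + η) :=
      (by fun_prop : Continuous fun ξ => ψ ξ • b (ξ + η)).integrable_of_hasCompactSupport
        hψs.smul_right
    rw [← hℓ, ← ℓ.integral_comp_comm hbi]
    have e1 : ∀ ξ, ℓ (ψ ξ • b (ξ + η)) = ∫ x, ψ ξ * (u x *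
        (Complex.exp (Complex.I * (ξ + η : ℝ) * birkhoffSum T φ k x) * h (T^[k] x))) ∂m := by
      intro ξ
      rw [map_smul, hℓ, hdual (ξ + η) h hh ⟨C', hC'⟩, smul_eq_mul, integral_const_mul]
    simp_rw [e1]
    rw [integral_integral_swap]
    · congr 1 with x
      rw [← integral_mul_const, ← integral_mul_const]
      congr 1 with ξ
      push_cast
      rw [mul_add, add_mul, Complex.exp_add]
      ring
    · refine Integrable.mono' (g := fun p : ℝ × X => ‖ψ p.1‖ * (C * C'))
        ((hψi.norm.mul_prod (integrable_const (μ := m) (C * C')))) ?_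
        (Eventually.of_forall fun p => ?_)
      · refine Measurable.aestronglyMeasurable ?_
        have := hψ.measurable
        unfold Function.uncurry
        fun_prop
      · rw [Function.uncurry, norm_mul, norm_mul, norm_mul, norm_exp_I_mul_ofReal_mul_ofReal,
          one_mul]
        refine mul_le_mul_of_nonneg_left ?_ (norm_nonneg _)
        exact mul_le_mul (hC _) (hC' _) (norm_nonneg _) ((norm_nonneg _).trans (hC p.2))

/-- The elements of the Banach space that encode the complete homogeneous sums of the values
`F (S_{k+1})`, where `F` is the Fourier transform of `ψ`. -/
noncomputable def encodedSum (P : ℝ → (B →L[ℂ] B)) (e : B) (ψ : ℝ → ℂ) : ℕ → ℕ → ℝ → B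
  | 0, k => fun η => ∫ ξ, ψ ξ • (P (ξ + η) ^ (k + 1)) e
  | j + 1, k => fun η => ∫ ξ, ψ ξ • ∑ l ∈ Finset.range (k + 1),
      (P (ξ + η) ^ (k - l)) (encodedSum P e ψ j l (ξ + η))

/-- The recursions of `completeSum` and `encodedSum` match: partial products ending at time `l + 1`
are carried to time `k + 1` by a power `k - l`, added up, and multiplied by the value of the Fourier
integral at `S_{k+1}`. The variable `η` stands for the total frequency of the factors still to come.
-/
theorem encodes_encodedSum [CompleteSpace B] (hT : MeasurePreserving T m m) (hφ : Measurable φ)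
    (hP : ∀ (t : ℝ) (b : B), ι (P t b) =ᵐ[m] charFunOperator m T φ t (ι b)) (hPc : Continuous P)
    {e : B} (h_one : ι e =ᵐ[m] fun _ => (1 : ℂ)) {ψ : ℝ → ℂ}
    (hψ : Continuous ψ) (hψs : HasCompactSupport ψ) (j k : ℕ) :
    Encodes m T φ ι (k + 1) (fun x => completeSum (fun l =>
      ∫ ξ, ψ ξ * Complex.exp (Complex.I * ξ * birkhoffSum T φ (l + 1) x)) j k)
      (encodedSum P e ψ j k) := by
  induction j generalizing k with
  | zero =>
    have h := ((encodes_one (T := T) (φ := φ) h_one).pow hT hφ hP hPc (k + 1)).mul_fourier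
      hT hφ hψ hψs
    rw [zero_add] at h
    simpa [completeSum, encodedSum] using h
  | succ j ih =>
    have h := (Encodes.sum hT hφ (k := k + 1) (s := Finset.range (k + 1)) fun l hl => by
      have h1 := (ih l).pow hT hφ hP hPc (k - l)
      have : l + 1 + (k - l) = k + 1 := by
        have := Finset.mem_range.1 hl
        omega
      rwa [this] at h1).mul_fourier hT hφ hψ hψs
    exact h

end Encodes

/-! ### Fourth moments of additive functionals -/

section Moments

/-- `∫ (1 + |y|)^(-4/3) dy`. -/
noncomputable def japaneseIntegral : ℝ := ∫ y : ℝ, (1 + |y|) ^ (-(4 / 3) : ℝ)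

theorem japaneseIntegral_nonneg : 0 ≤ japaneseIntegral :=
  integral_nonneg fun y => by positivity

theorem integrable_one_add_abs_rpow : Integrable fun y : ℝ => (1 + |y|) ^ (-(4 / 3) : ℝ) := by
  have := integrable_one_add_norm (E := ℝ) (μ := volume) (r := 4 / 3) (by norm_num)
  simpa only [Real.norm_eq_abs] using this

theorem integrable_one_add_mul_abs_add_rpow {c : ℝ} (hc : 0 < c) (η : ℝ) :
    Integrable fun ξ : ℝ => (1 + c * |ξ + η|) ^ (-(4 / 3) : ℝ) := by
  have h1 := (integrable_one_add_abs_rpow.comp_mul_left' hc.ne').comp_add_right η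
  simpa only [abs_mul, abs_of_pos hc] using h1

theorem integral_one_add_mul_abs_add_rpow {c : ℝ} (hc : 0 < c) (η : ℝ) :
    ∫ ξ : ℝ, (1 + c * |ξ + η|) ^ (-(4 / 3) : ℝ) = c⁻¹ * japaneseIntegral := by
  rw [integral_add_right_eq_self fun ξ : ℝ => (1 + c * |ξ|) ^ (-(4 / 3) : ℝ)]
  have := Measure.integral_comp_mul_left (fun y : ℝ => (1 + |y|) ^ (-(4 / 3) : ℝ)) c
  simpa only [abs_mul, abs_of_pos hc, abs_of_pos (inv_pos.2 hc), smul_eq_mul,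
    japaneseIntegral] using this

/-- Submultiplicativity of the weight lets the growth of `ψ` in `ξ` be charged partly to the
operator frequency `ξ + η` and partly to `η`. -/
theorem one_add_mul_abs_le {c : ℝ} (hc : 0 ≤ c) (ξ η : ℝ) :
    1 + c * |ξ| ≤ (1 + c * |ξ + η|) * (1 + c * |η|) := by
  have h1 : |ξ| ≤ |ξ + η| + |η| := by
    have := abs_sub (ξ + η) η
    rwa [add_sub_cancel_right] at this
  have h2 : 0 ≤ c * |ξ + η| := by positivity
  have h3 : 0 ≤ c * |η| := by positivity
  have h4 := mul_le_mul_of_nonneg_left h1 hc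
  nlinarith [mul_nonneg h2 h3]

variable {B : Type*} [NormedAddCommGroup B] [NormedSpace ℂ B]

/-- One round of the moment iteration. The decay `-5/3` of the integrand and the growth `1/3` of `ψ`
leave the integrable exponent `-4/3`, whose integral supplies the factor `a⁻¹`; what remains is
growth `1/3` in the outer frequency, which the next round can absorb. -/
theorem sum_norm_integral_smul_le {c : ℕ → ℝ → B} (hc : ∀ k, Continuous (c k)) {ψ : ℝ → ℂ}
    (hψ : Continuous ψ) (hψs : HasCompactSupport ψ) {R ρ D K a : ℝ} {n : ℕ} (ha : 0 < a)
    (hD : 0 ≤ D) (hK : 0 ≤ K) (hψR : ∀ ξ, R < |ξ| → ψ ξ = 0)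
    (hψD : ∀ ξ, ‖ψ ξ‖ ≤ D * (1 + a * |ξ|) ^ (1 / 3 : ℝ))
    (hcK : ∀ ζ, |ζ| ≤ ρ + R →
      ∑ k ∈ Finset.range n, ‖c k ζ‖ ≤ K * (1 + a * |ζ|) ^ (-(5 / 3) : ℝ))
    {η : ℝ} (hη : |η| ≤ ρ) :
    ∑ k ∈ Finset.range n, ‖∫ ξ, ψ ξ • c k (ξ + η)‖ ≤
      D * K * (a⁻¹ * japaneseIntegral) * (1 + a * |η|) ^ (1 / 3 : ℝ) := by
  have hint : ∀ k, Integrable fun ξ => ‖ψ ξ‖ * ‖c k (ξ + η)‖ := fun k => by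
    have := hc k
    exact (by fun_prop : Continuous fun ξ => ‖ψ ξ‖ * ‖c k (ξ + η)‖).integrable_of_hasCompactSupport
      hψs.norm.mul_right
  calc ∑ k ∈ Finset.range n, ‖∫ ξ, ψ ξ • c k (ξ + η)‖
      ≤ ∑ k ∈ Finset.range n, ∫ ξ, ‖ψ ξ‖ * ‖c k (ξ + η)‖ := by
        refine Finset.sum_le_sum fun k _ => (norm_integral_le_integral_norm _).trans (le_of_eq ?_)
        simp_rw [norm_smul]
    _ = ∫ ξ, ‖ψ ξ‖ * ∑ k ∈ Finset.range n, ‖c k (ξ + η)‖ := by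
        rw [← integral_finsetSum _ fun k _ => hint k]
        simp_rw [Finset.mul_sum]
    _ ≤ ∫ ξ, D * K * (1 + a * |η|) ^ (1 / 3 : ℝ) * (1 + a * |ξ + η|) ^ (-(4 / 3) : ℝ) := by
        refine integral_mono_of_nonneg (Eventually.of_forall fun ξ => ?_)
          ((integrable_one_add_mul_abs_add_rpow ha η).const_mul _)
          (Eventually.of_forall fun ξ => ?_)
        · exact mul_nonneg (norm_nonneg _) (Finset.sum_nonneg fun _ _ => norm_nonneg _)
        · have hw : 0 < 1 + a * |ξ + η| := by positivity
          have hw' : 0 < 1 + a * |η| := by positivity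
          rcases lt_or_ge R |ξ| with h | h
          · simp only [hψR ξ h, norm_zero, zero_mul]
            positivity
          · have h1 : |ξ + η| ≤ ρ + R := (abs_add_le _ _).trans (by linarith)
            have h2 : ‖ψ ξ‖ ≤ D * ((1 + a * |ξ + η|) ^ (1 / 3 : ℝ) *
                (1 + a * |η|) ^ (1 / 3 : ℝ)) := by
              rw [← Real.mul_rpow hw.le hw'.le]
              refine (hψD ξ).trans ?_
              gcongr
              exact one_add_mul_abs_le ha.le ξ η
            calc ‖ψ ξ‖ * ∑ k ∈ Finset.range n, ‖c k (ξ + η)‖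
                ≤ D * ((1 + a * |ξ + η|) ^ (1 / 3 : ℝ) * (1 + a * |η|) ^ (1 / 3 : ℝ)) *
                  (K * (1 + a * |ξ + η|) ^ (-(5 / 3) : ℝ)) := by
                  gcongr
                  exact hcK _ h1
              _ = D * K * (1 + a * |η|) ^ (1 / 3 : ℝ) *
                  ((1 + a * |ξ + η|) ^ (1 / 3 : ℝ) * (1 + a * |ξ + η|) ^ (-(5 / 3) : ℝ)) := by
                  ring
              _ = _ := by
                  rw [← Real.rpow_add hw]
                  norm_num
    _ = _ := by
        rw [integral_const_mul, integral_one_add_mul_abs_add_rpow ha]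
        ring

theorem continuous_encodedSum {P : ℝ → (B →L[ℂ] B)} (hP : Continuous P) (e : B) {ψ : ℝ → ℂ}
    (hψ : Continuous ψ) (hψs : HasCompactSupport ψ) (j k : ℕ) :
    Continuous (encodedSum P e ψ j k) := by
  have key : ∀ c : ℝ → B, Continuous c → Continuous fun η => ∫ ξ, ψ ξ • c (ξ + η) := by
    intro c hc
    rw [← continuousOn_univ]
    refine continuousOn_integral_of_compact_support (k := tsupport ψ) hψs ?_ fun p ξ _ hξ => ?_
    · exact (by fun_prop : Continuous (Function.uncurry fun η ξ => ψ ξ • c (ξ + η))).continuousOn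
    · rw [image_eq_zero_of_notMem_tsupport hξ, zero_smul]
  induction j generalizing k with
  | zero => exact key (fun ζ => (P ζ ^ (k + 1)) e) (by fun_prop)
  | succ j ih =>
    exact key (fun ζ => ∑ l ∈ Finset.range (k + 1), (P ζ ^ (k - l)) (encodedSum P e ψ j l ζ))
      (continuous_finsetSum _ fun l _ => (hP.pow _).clm_apply (ih l))

/-- Norm bounds for the encoded complete homogeneous sums. -/
theorem sum_norm_encodedSum_le {P : ℝ → (B →L[ℂ] B)} (hP : Continuous P) (e : B) {ψ : ℝ → ℂ}
    (hψ : Continuous ψ) (hψs : HasCompactSupport ψ) {R D C : ℝ} {n : ℕ} (hn : 1 ≤ n) (hR : 0 ≤ R)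
    (hD : 0 ≤ D) (hC : 0 ≤ C) (hψR : ∀ ξ, R < |ξ| → ψ ξ = 0)
    (hψD : ∀ ξ, ‖ψ ξ‖ ≤ D * (1 + √n * |ξ|) ^ (1 / 3 : ℝ)) {J : ℕ}
    (hsum : ∀ u, |u| ≤ (J + 1) * R →
      ∑ j ∈ Finset.range (n + 1), ‖P u ^ j‖ ≤ C * n / (1 + √n * |u|) ^ 2)
    {j : ℕ} (hj : j ≤ J) {η : ℝ} (hη : |η| ≤ (J - j) * R) :
    ∑ k ∈ Finset.range n, ‖encodedSum P e ψ j k η‖ ≤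
      (D * C * japaneseIntegral * √n) ^ (j + 1) * ‖e‖ * (1 + √n * |η|) ^ (1 / 3 : ℝ) := by
  have hsqrt : 0 < √(n : ℝ) := Real.sqrt_pos.2 (by exact_mod_cast hn)
  have hnn : (n : ℝ) = √(n : ℝ) * √(n : ℝ) := (Real.mul_self_sqrt (Nat.cast_nonneg n)).symm
  have hI := japaneseIntegral_nonneg
  have hpow : ∀ ζ : ℝ, C * n / (1 + √n * |ζ|) ^ 2 = C * n * (1 + √n * |ζ|) ^ (-2 : ℝ) := by
    intro ζ
    rw [Real.rpow_neg (by positivity), div_eq_mul_inv]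
    norm_cast
  induction j generalizing η with
  | zero =>
    have h := sum_norm_integral_smul_le (c := fun k ζ => (P ζ ^ (k + 1)) e) (fun k => by fun_prop)
      hψ hψs (n := n) (K := C * n * ‖e‖) (ρ := (J - (0 : ℕ)) * R) hsqrt hD
      (by positivity) hψR hψD ?_ hη
    · refine h.trans (le_of_eq ?_)
      rw [zero_add, pow_one]
      congr 1
      have : D * (C * n * ‖e‖) * ((√n)⁻¹ * japaneseIntegral) =
          D * C * japaneseIntegral * ‖e‖ * (n * (√(n : ℝ))⁻¹) := by ring
      rw [this, hnn, Real.sqrt_mul_self (Real.sqrt_nonneg _), mul_inv_cancel_right₀ hsqrt.ne']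
      ring
    · intro ζ hζ
      have hw : 1 ≤ 1 + √(n : ℝ) * |ζ| := by
        have : 0 ≤ √(n : ℝ) * |ζ| := by positivity
        linarith
      -- The first factor sits at a time between `1` and `n`, so the powers `1, …, n` occur; this is
      -- why the hypothesis sums over `range (n + 1)`.
      have h1 : ∑ k ∈ Finset.range n, ‖P ζ ^ (k + 1)‖ ≤ C * n * (1 + √n * |ζ|) ^ (-2 : ℝ) := by
        rw [← hpow]
        refine le_trans ?_ (hsum ζ (hζ.trans (le_of_eq ?_)))
        · rw [Finset.sum_range_succ']
          linarith [norm_nonneg (P ζ ^ 0)]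
        · push_cast
          ring
      calc ∑ k ∈ Finset.range n, ‖(P ζ ^ (k + 1)) e‖
          ≤ (∑ k ∈ Finset.range n, ‖P ζ ^ (k + 1)‖) * ‖e‖ := by
            rw [Finset.sum_mul]
            exact Finset.sum_le_sum fun k _ => ContinuousLinearMap.le_opNorm _ _
        _ ≤ C * n * (1 + √n * |ζ|) ^ (-(5 / 3) : ℝ) * ‖e‖ := by
            gcongr
            refine h1.trans ?_
            exact mul_le_mul_of_nonneg_left (Real.rpow_le_rpow_of_exponent_le hw (by norm_num))
              (by positivity)
        _ = _ := by ring
  | succ j ih =>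
    -- Every further degree costs one factor `L`: `D` from `ψ`, `C n` from the powers, and
    -- `japaneseIntegral / √n` from the frequency integral. The decay available is `-2 + 1/3 =
    -- -5/3`.
    set L := D * C * japaneseIntegral * √n with hL
    have hL0 : 0 ≤ L := by positivity
    have h := sum_norm_integral_smul_le (c := fun k ζ => ∑ l ∈ Finset.range (k + 1),
        (P ζ ^ (k - l)) (encodedSum P e ψ j l ζ))
      (fun k => continuous_finsetSum _ fun l _ =>
        (hP.pow _).clm_apply (continuous_encodedSum hP e hψ hψs j l))
      hψ hψs (n := n) (K := C * n * (L ^ (j + 1) * ‖e‖)) (ρ := (J - (j + 1 : ℕ)) * R)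
      hsqrt hD (by positivity) hψR hψD ?_ hη
    · refine h.trans (le_of_eq ?_)
      congr 1
      have : D * (C * n * (L ^ (j + 1) * ‖e‖)) * ((√n)⁻¹ * japaneseIntegral) =
          D * C * japaneseIntegral * (n * (√(n : ℝ))⁻¹) * L ^ (j + 1) * ‖e‖ := by ring
      have h2 : (n : ℝ) * (√(n : ℝ))⁻¹ = √n := by
        nth_rw 1 [hnn]
        rw [mul_inv_cancel_right₀ hsqrt.ne']
      rw [this, h2, ← hL, pow_succ' L (j + 1)]
    · intro ζ hζ
      have hw : 0 < 1 + √(n : ℝ) * |ζ| := by positivity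
      have hζ' : |ζ| ≤ (J - j) * R := hζ.trans (le_of_eq (by push_cast; ring))
      have h1 : ∑ k ∈ Finset.range n, ‖P ζ ^ k‖ ≤ C * n * (1 + √n * |ζ|) ^ (-2 : ℝ) := by
        rw [← hpow]
        refine le_trans ?_ (hsum ζ (hζ'.trans ?_))
        · rw [Finset.sum_range_succ]
          linarith [norm_nonneg (P ζ ^ n)]
        · gcongr
          linarith [(Nat.cast_nonneg j : (0 : ℝ) ≤ j)]
      calc ∑ k ∈ Finset.range n, ‖∑ l ∈ Finset.range (k + 1),
            (P ζ ^ (k - l)) (encodedSum P e ψ j l ζ)‖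
          ≤ ∑ k ∈ Finset.range n, ∑ l ∈ Finset.range (k + 1),
            ‖P ζ ^ (k - l)‖ * ‖encodedSum P e ψ j l ζ‖ := by
            refine Finset.sum_le_sum fun k _ => (norm_sum_le _ _).trans ?_
            exact Finset.sum_le_sum fun l _ => ContinuousLinearMap.le_opNorm _ _
        _ ≤ (∑ k ∈ Finset.range n, ‖P ζ ^ k‖) * ∑ k ∈ Finset.range n, ‖encodedSum P e ψ j k ζ‖ :=
            sum_convolution_le (p := fun k => ‖P ζ ^ k‖) (fun _ => norm_nonneg _)
              (fun _ => norm_nonneg _) n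
        _ ≤ (C * n * (1 + √n * |ζ|) ^ (-2 : ℝ)) *
            (L ^ (j + 1) * ‖e‖ * (1 + √n * |ζ|) ^ (1 / 3 : ℝ)) := by
            gcongr
            exact ih (by omega) hζ'
        _ = C * n * (L ^ (j + 1) * ‖e‖) *
            ((1 + √n * |ζ|) ^ (-2 : ℝ) * (1 + √n * |ζ|) ^ (1 / 3 : ℝ)) := by ring
        _ = _ := by
            rw [← Real.rpow_add hw]
            norm_num

variable {X : Type*} [MeasurableSpace X] {m : Measure X} [IsProbabilityMeasure m]
  {T : X → X} {φ : X → ℝ} {ι : B →L[ℂ] Lp ℂ ∞ m} {P : ℝ → (B →L[ℂ] B)}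

/-- The fourth moment bound. -/
theorem exists_integral_sum_pow_four_le [CompleteSpace B] (hT : MeasurePreserving T m m)
    (hφ : Measurable φ)
    (hP : ∀ (t : ℝ) (b : B), ι (P t b) =ᵐ[m] charFunOperator m T φ t (ι b)) (hPc : Continuous P)
    {e : B} (h_one : ι e =ᵐ[m] fun _ => (1 : ℂ)) {R C : ℝ} (hR : 0 ≤ R) (hC : 0 ≤ C)
    (hsum : ∀ n : ℕ, 1 ≤ n → ∀ u, |u| ≤ 4 * R →
      ∑ j ∈ Finset.range (n + 1), ‖P u ^ j‖ ≤ C * n / (1 + √n * |u|) ^ 2) :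
    ∃ C', 0 ≤ C' ∧ ∀ (n : ℕ) (D : ℝ) (ψ : ℝ → ℂ) (F : ℝ → ℝ), 1 ≤ n → 0 ≤ D → Continuous ψ →
      (∀ ξ, R < |ξ| → ψ ξ = 0) → (∀ ξ, ‖ψ ξ‖ ≤ D * (1 + √n * |ξ|) ^ (1 / 3 : ℝ)) →
      (∀ s : ℝ, (F s : ℂ) = ∫ ξ : ℝ, ψ ξ * Complex.exp (Complex.I * ξ * s)) →
      ∫ x, (∑ k ∈ Finset.range n, F (birkhoffSum T φ (k + 1) x)) ^ 4 ∂m ≤ C' * D ^ 4 * n ^ 2 := by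
  obtain ⟨ℓ, hℓ⟩ := exists_clm_eq_integral_mul ι (h := fun _ => (1 : ℂ)) measurable_const (C := 1)
    (by simp)
  have hI := japaneseIntegral_nonneg
  refine ⟨24 * (‖ℓ‖ * ((C * japaneseIntegral) ^ 4 * ‖e‖)), by positivity, ?_⟩
  intro n D ψ F hn hD hψ hψR hψD hF
  have hψs : HasCompactSupport ψ := HasCompactSupport.intro (K := Set.Icc (-R) R) isCompact_Icc
    fun ξ hξ => hψR ξ (not_le.1 fun h => hξ (abs_le.1 h))
  set a : X → ℕ → ℝ := fun x l => F (birkhoffSum T φ (l + 1) x) with ha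
  have henc : ∀ k, Encodes m T φ ι (k + 1) (fun x => ((completeSum (a x) 3 k : ℝ) : ℂ))
      (encodedSum P e ψ 3 k) := by
    intro k
    have := encodes_encodedSum hT hφ hP hPc h_one hψ hψs 3 k
    simp_rw [← hF] at this
    simpa only [ofReal_completeSum] using this
  have hint : ∀ k, Integrable (fun x => completeSum (a x) 3 k) m := by
    intro k
    obtain ⟨hu, ⟨C', hC'⟩, -⟩ := henc k
    have : Integrable (fun x => ((completeSum (a x) 3 k : ℝ) : ℂ)) m :=
      Integrable.of_bound hu.aestronglyMeasurable C' (Eventually.of_forall hC')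
    simpa using this.re
  have hval : ∀ k, ∫ x, completeSum (a x) 3 k ∂m ≤ ‖ℓ‖ * ‖encodedSum P e ψ 3 k 0‖ := by
    intro k
    have h1 := (henc k).2.2.2 0 (fun _ => 1) measurable_const ⟨1, by simp⟩
    simp only [Complex.ofReal_zero, mul_zero, zero_mul, Complex.exp_zero, mul_one] at h1
    have h2 : ℓ (encodedSum P e ψ 3 k 0) = ((∫ x, completeSum (a x) 3 k ∂m : ℝ) : ℂ) := by
      rw [hℓ]
      simp only [mul_one]
      rw [h1]
      exact integral_ofReal
    refine (le_abs_self _).trans ?_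
    rw [← Real.norm_eq_abs, ← Complex.norm_real, ← h2]
    exact ℓ.le_opNorm _
  -- After the fourth factor no frequency is outstanding, so `η = 0`; the intermediate totals
  -- involve at most four frequencies of size `R`, whence the range `4 * R`.
  have hbound := sum_norm_encodedSum_le hPc e hψ hψs hn hR hD hC hψR hψD (J := 3) (j := 3)
    (fun u hu => hsum n hn u (hu.trans (le_of_eq (by push_cast; ring)))) le_rfl (η := 0) (by simp)
  simp only [abs_zero, mul_zero, add_zero, Real.one_rpow, mul_one] at hbound
  have hsq : √(n : ℝ) ^ 4 = n ^ 2 := by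
    rw [show 4 = 2 * 2 from rfl, pow_mul, Real.sq_sqrt (Nat.cast_nonneg n)]
  calc ∫ x, (∑ k ∈ Finset.range n, a x k) ^ 4 ∂m
      ≤ ∫ x, 24 * ∑ k ∈ Finset.range n, completeSum (a x) 3 k ∂m := by
        refine integral_mono_of_nonneg (Eventually.of_forall fun x => by positivity)
          ((integrable_finsetSum _ fun k _ => hint k).const_mul 24)
          (Eventually.of_forall fun x => sum_pow_four_le_completeSum (a x) n)
    _ = 24 * ∑ k ∈ Finset.range n, ∫ x, completeSum (a x) 3 k ∂m := by
        rw [integral_const_mul, integral_finsetSum _ fun k _ => hint k]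
    _ ≤ 24 * (‖ℓ‖ * ∑ k ∈ Finset.range n, ‖encodedSum P e ψ 3 k 0‖) := by
        refine mul_le_mul_of_nonneg_left ?_ (by norm_num)
        rw [Finset.mul_sum]
        exact Finset.sum_le_sum fun k _ => hval k
    _ ≤ 24 * (‖ℓ‖ * ((D * C * japaneseIntegral * √n) ^ (3 + 1) * ‖e‖)) := by gcongr
    _ = _ := by
        rw [show 3 + 1 = 4 from rfl, mul_pow _ (√(n : ℝ)), hsq]
        ring

end Moments

/-! ### Fourier representation of the smoothing function -/

section Fourier

/-- A compactly supported continuous Fourier transform is integrable, so inversion holds pointwise.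
The density `ψ` is that transform rescaled by `2π` to pass to the kernel `exp(iξs)`. -/
theorem exists_fourier_representation {f : ℝ → ℝ} (hf : Continuous f) (hfi : Integrable f)
    (hfs : HasCompactSupport (𝓕 (fun y : ℝ => (f y : ℂ)))) :
    ∃ (ψ : ℝ → ℂ) (R M : ℝ), Continuous ψ ∧ 0 ≤ R ∧ 0 ≤ M ∧ (∀ ξ, R < |ξ| → ψ ξ = 0) ∧
      (∀ ξ, ‖ψ ξ‖ ≤ M) ∧
      ∀ s : ℝ, (f s : ℂ) = ∫ ξ : ℝ, ψ ξ * Complex.exp (Complex.I * ξ * s) := by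
  set g : ℝ → ℂ := fun y => (f y : ℂ) with hg
  have hgc : Continuous g := Complex.continuous_ofReal.comp hf
  have hgi : Integrable g := hfi.ofReal
  have hFc : Continuous (𝓕 g) :=
    VectorFourier.fourierIntegral_continuous Real.continuous_fourierChar
      (by exact continuous_inner) hgi
  have hFi : Integrable (𝓕 g) := hFc.integrable_of_hasCompactSupport hfs
  have hpi : (0 : ℝ) < 2 * Real.pi := by positivity
  set ψ : ℝ → ℂ := fun ξ => ((2 * Real.pi)⁻¹ : ℝ) * 𝓕 g ((2 * Real.pi)⁻¹ * ξ) with hψ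
  have hψc : Continuous ψ := by fun_prop
  have hψs : HasCompactSupport ψ := by
    have h1 : HasCompactSupport fun ξ : ℝ => 𝓕 g ((2 * Real.pi)⁻¹ * ξ) :=
      hfs.comp_homeomorph (Homeomorph.mulLeft₀ (2 * Real.pi)⁻¹ (inv_pos.2 hpi).ne')
    exact h1.mul_left
  obtain ⟨R, hR⟩ := hψs.isCompact.isBounded.subset_closedBall (0 : ℝ)
  obtain ⟨M, hM⟩ := hψs.exists_bound_of_continuous hψc
  refine ⟨ψ, |R|, M, hψc, abs_nonneg R, (norm_nonneg _).trans (hM 0), fun ξ hξ => ?_, hM,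
    fun s => ?_⟩
  · by_contra h0
    have := hR (subset_tsupport ψ h0)
    rw [mem_closedBall_zero_iff, Real.norm_eq_abs] at this
    linarith [le_abs_self R]
  · have h1 : g s = 𝓕⁻ (𝓕 g) s := by rw [hgc.fourierInv_fourier_eq hgi hFi]
    have h2 := Measure.integral_comp_mul_left
      (fun ξ : ℝ => 𝓕 g ξ * Complex.exp (Complex.I * (2 * Real.pi * ξ : ℝ) * s)) (2 * Real.pi)⁻¹
    change g s = _
    rw [h1, Real.fourierInv_eq']
    rw [inv_inv, abs_of_pos hpi] at h2
    calc ∫ v : ℝ, Complex.exp (((2 * Real.pi * inner ℝ v s : ℝ) : ℂ) * Complex.I) • 𝓕 g v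
        = ∫ ξ : ℝ, 𝓕 g ξ * Complex.exp (Complex.I * (2 * Real.pi * ξ : ℝ) * s) := by
          congr 1 with v
          rw [smul_eq_mul, mul_comm]
          congr 2
          simp
          ring
      _ = (2 * Real.pi)⁻¹ • ∫ ξ : ℝ, 𝓕 g ((2 * Real.pi)⁻¹ * ξ) * Complex.exp (Complex.I *
            (2 * Real.pi * ((2 * Real.pi)⁻¹ * ξ) : ℝ) * s) := by
          rw [h2, smul_smul, inv_mul_cancel₀ hpi.ne', one_smul]
      _ = _ := by
          rw [← integral_smul]
          congr 1 with ξ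
          rw [mul_inv_cancel_left₀ hpi.ne', Complex.real_smul, ← mul_assoc]

/-- Interpolation between the Lipschitz bound `|a - b|` and the trivial bound `2`. -/
theorem norm_exp_sub_exp_le (a b : ℝ) :
    ‖Complex.exp (-(Complex.I * a)) - Complex.exp (-(Complex.I * b))‖ ≤
      2 * |a - b| ^ (1 / 3 : ℝ) := by
  have e1 : Complex.exp (-(Complex.I * a)) - Complex.exp (-(Complex.I * b)) =
      Complex.exp (Complex.I * ((-b : ℝ) : ℂ)) *
        (Complex.exp (Complex.I * ((b - a : ℝ) : ℂ)) - 1) := by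
    rw [mul_sub, ← Complex.exp_add]
    push_cast
    ring_nf
  have e2 : ∀ c : ℝ, ‖Complex.exp (Complex.I * c)‖ = 1 := fun c => by
    rw [mul_comm, Complex.norm_exp_ofReal_mul_I]
  rw [e1, norm_mul, e2, one_mul, abs_sub_comm]
  rcases le_total |b - a| 1 with h | h
  · refine Real.norm_exp_I_mul_ofReal_sub_one_le.trans ?_
    have h1 := Real.rpow_le_rpow_of_exponent_ge_of_imp (abs_nonneg (b - a)) h
      (by norm_num : (1 / 3 : ℝ) ≤ 1) (by norm_num)
    rw [Real.rpow_one] at h1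
    rw [Real.norm_eq_abs]
    linarith [Real.rpow_nonneg (abs_nonneg (b - a)) (1 / 3 : ℝ)]
  · have h1 : (1 : ℝ) ≤ |b - a| ^ (1 / 3 : ℝ) := Real.one_le_rpow h (by norm_num)
    refine (norm_sub_le _ _).trans ?_
    rw [e2, norm_one]
    linarith

end Fourier

/-! ### The smoothed local times -/

section LocalTime

theorem localTime_apply {X : Type*} (T : X → X) (φ : X → ℝ) (f : C(ℝ, ℝ)) (n : ℕ) (x : X) (y : ℝ) :
    localTime T φ f n x y = (√(n : ℝ))⁻¹ *
      ∑ k ∈ Finset.range n, f (birkhoffSum T φ (k + 1) x - √(n : ℝ) * y) := by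
  have h : ∑ k ∈ Finset.Icc 1 n, f (birkhoffSum T φ k x - √(n : ℝ) * y) =
      ∑ k ∈ Finset.range n, f (birkhoffSum T φ (k + 1) x - √(n : ℝ) * y) := by
    rw [Finset.range_eq_Ico, Finset.sum_Ico_add' (fun k => f (birkhoffSum T φ k x - √(n : ℝ) * y))]
    rfl
  exact congrArg _ h

variable {X : Type*} [MeasurableSpace X]

/-- The path `l_n` is a continuous image of the sequence of partial sums, which is measurable
coordinate by coordinate. -/
theorem measurable_localTime {T : X → X} (hT : Measurable T) {φ : X → ℝ} (hφ : Measurable φ)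
    (f : C(ℝ, ℝ)) (n : ℕ) : Measurable (localTime T φ f n) := by
  let G : (ℕ → ℝ) → C(ℝ, ℝ) := fun s =>
    ⟨fun y => (√(n : ℝ))⁻¹ * ∑ k ∈ Finset.Icc 1 n, f (s k - √(n : ℝ) * y), by fun_prop⟩
  have hG : Continuous G := ContinuousMap.continuous_of_continuous_uncurry _ (by
    simp only [G, Function.uncurry_def, ContinuousMap.coe_mk]
    fun_prop)
  have hS : Measurable fun x k => birkhoffSum T φ k x :=
    measurable_pi_lambda _ fun k => measurable_birkhoffSum hT hφ k
  exact hG.measurable.comp hS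

variable {m : Measure X} [IsProbabilityMeasure m]

theorem measure_le_abs_le_of_fourth_moment {g : X → ℝ} (hg : Integrable (fun x => g x ^ 4) m)
    {K : ℝ} {n : ℕ} (hn : 1 ≤ n) (hK : ∫ x, g x ^ 4 ∂m ≤ K * n ^ 2) {a : ℝ} (ha : 0 < a) :
    m {x | a ≤ |(√(n : ℝ))⁻¹ * g x|} ≤ ENNReal.ofReal (K / a ^ (4 : ℝ)) := by
  have hn' : (0 : ℝ) < n := by exact_mod_cast hn
  have hs : 0 < √(n : ℝ) := Real.sqrt_pos.2 hn'
  have hs4 : √(n : ℝ) ^ 4 = n ^ 2 := by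
    rw [show 4 = 2 * 2 from rfl, pow_mul, Real.sq_sqrt hn'.le]
  have hsub : {x | a ≤ |(√(n : ℝ))⁻¹ * g x|} ⊆ {x | a ^ 4 * n ^ 2 ≤ g x ^ 4} := by
    intro x hx
    have hx : a ≤ |(√(n : ℝ))⁻¹ * g x| := hx
    have h1 : a * √(n : ℝ) ≤ |g x| := by
      rw [abs_mul, abs_of_pos (inv_pos.2 hs), inv_mul_eq_div, le_div_iff₀ hs] at hx
      exact hx
    have h2 := pow_le_pow_left₀ (by positivity) h1 4
    rw [mul_pow, hs4, Even.pow_abs (by decide)] at h2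
    exact h2
  have h3 := mul_meas_ge_le_integral_of_nonneg (Eventually.of_forall fun x => by positivity) hg
    (a ^ 4 * n ^ 2)
  refine (measure_mono hsub).trans ?_
  rw [← ofReal_measureReal]
  refine ENNReal.ofReal_le_ofReal ?_
  have e4 : a ^ (4 : ℝ) = a ^ 4 := by norm_cast
  rw [e4, le_div_iff₀ (by positivity)]
  have h4 := h3.trans hK
  have hn2 : (0 : ℝ) < n ^ 2 := by positivity
  nlinarith

end LocalTime

/-! ### The marginal at time one -/

section Marginal

namespace SkorokhodSpace

/-- Every increasing time change fixes the endpoint `1`, so closeness up to a time change controls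
the value there. -/
theorem continuous_eval_one : Continuous fun x : SkorokhodSpace => x.toFun 1 := by
  refine ⟨fun U hU x hx => ?_⟩
  obtain ⟨ε, hε, hball⟩ := Metric.isOpen_iff.1 hU _ hx
  refine ⟨ε, hε, fun y ⟨τ, hτ⟩ => hball ?_⟩
  have h1 : τ 1 = 1 := map_top τ
  have h2 := (hτ 1).2
  rw [h1] at h2
  rwa [Metric.mem_ball, dist_comm, Real.dist_eq]

end SkorokhodSpace

theorem IsBrownianWithVariance.map_eval_one {Ω : Type*} [MeasurableSpace Ω] {Q : Measure Ω}
    {W : Ω → SkorokhodSpace} {v : ℝ} (hv : 0 < v) (hW : IsBrownianWithVariance W Q v) :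
    Q.map (fun w => (W w).toFun 1) = gaussianReal 0 v.toNNReal := by
  obtain ⟨β, hβ, hWβ⟩ := hW
  have h1 : (fun w => (W w).toFun 1) =ᵐ[Q] fun w => √v * β 1 w := by
    filter_upwards [hWβ] with w hw
    simpa using hw 1
  have hlaw := hβ.toIsPreBrownianReal.hasLaw_eval 1
  rw [Measure.map_congr h1]
  have h2 : Q.map (fun w => √v * β 1 w) = (Q.map (β 1)).map (√v * ·) := by
    rw [AEMeasurable.map_map_of_aemeasurable (by fun_prop) hlaw.aemeasurable]
    rfl
  rw [h2, hlaw.map_eq, gaussianReal_map_const_mul, mul_zero, mul_one]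
  congr 1
  ext
  simp [Real.sq_sqrt hv.le, hv.le]

end Marginal

/-- Tightness of the smoothed local times in `C(ℝ)` under (A1)-(A7). -/
theorem mainTheorem4
    {X : Type*} [MeasurableSpace X] (m : Measure X) [IsProbabilityMeasure m]
    (T : X → X) (hT : MeasurePreserving T m m)
    (φ : X → ℝ) (hφ : Measurable φ)
    -- (A1): a Banach space `B ⊆ L^∞(m)`, continuously embedded by `ι`, that contains the constant `e = 1` and is
    -- closed under complex conjugation and absolute value
    {B : Type*} [NormedAddCommGroup B] [NormedSpace ℂ B] [CompleteSpace B]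
    (ι : B →L[ℂ] Lp ℂ ∞ m) (hι : Function.Injective ι)
    (e : B) (h_one : ι e =ᵐ[m] fun _ => (1 : ℂ))
    (h_conj : ∀ b : B, ∃ b' : B, ι b' =ᵐ[m] fun x => starRingEnd ℂ (ι b x))
    (h_abs : ∀ b : B, ∃ b' : B, ι b' =ᵐ[m] fun x => ((‖ι b x‖ : ℝ) : ℂ))
    -- the characteristic function operators preserve `B` and act on it as bounded operators;
    -- in particular `P 0` is the transfer operator on `B`
    (P : ℝ → (B →L[ℂ] B))
    (hP : ∀ (t : ℝ) (b : B), ι (P t b) =ᵐ[m] charFunOperator m T φ t (ι b))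
    -- (A2): quasi-compactness
    (hA2 : IsQuasiCompact (P 0) (fun _ : Fin 1 => (1 : ℂ)))
    (N : B →L[ℂ] B) (hN : ∀ b : B, P 0 b = (∫ x, ι b x ∂m) • e + N b)
    (hN_radius : spectralRadius ℂ N < 1)
    -- (A3): finite second moment and mean zero
    (hφ2 : MemLp φ 2 m) (hφ0 : ∫ x, φ x ∂m = 0)
    -- (A4): continuity
    (hA4 : Continuous P)
    -- (A5): differentiability
    (I₀ : Set ℝ) (hI₀ : IsOpen I₀) (hI₀_zero : (0 : ℝ) ∈ I₀) (hA5 : ContDiffOn ℝ 2 P I₀)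
    (hP' : ∀ b : B, ι (deriv P 0 b) =ᵐ[m]
      transferOperator m T (fun x => Complex.I * φ x * ι b x))
    (hP'' : ∀ b : B, ι (iteratedDeriv 2 P 0 b) =ᵐ[m]
      transferOperator m T (fun x => -(φ x : ℂ) ^ 2 * ι b x))
    -- (A6): aperiodicity
    (hA6 : ∀ t : ℝ, t ≠ 0 → spectralRadius ℂ (P t) < 1)
    -- (A7): the functional invariance principle in the Skorokhod space
    {Ω : Type*} [MeasurableSpace Ω] (Q : Measure Ω) [IsProbabilityMeasure Q]
    (W : Ω → SkorokhodSpace) (v : ℝ) (hv : 0 < v) (hW : IsBrownianWithVariance W Q v)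
    (hA7 : TendstoInDistribution (fun (n : ℕ) x => partialSumPath T φ n x) atTop W
      (fun _ => m) Q)
    -- the smoothing function
    (f : C(ℝ, ℝ)) (hf_smooth : ContDiff ℝ ∞ f) (hf_int : Integrable f)
    (hf_symm : ∀ y, f (-y) = f y)
    (hf_fourier : HasCompactSupport (𝓕 (fun y : ℝ => (f y : ℂ)))) :
    (∀ n : ℕ, Measurable (localTime T φ f n)) ∧
      IsTightMeasureSet {ν : Measure C(ℝ, ℝ) | ∃ n : ℕ, 1 ≤ n ∧ ν = m.map (localTime T φ f n)} := by
  refine ⟨measurable_localTime hT.measurable hφ f, ?_⟩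
  have hS : ∀ n, Measurable (birkhoffSum T φ n) := measurable_birkhoffSum hT.measurable hφ
  -- the expectation as a functional on `B`
  obtain ⟨ℓ, hℓ'⟩ := exists_clm_eq_integral_mul ι (h := fun _ => (1 : ℂ)) measurable_const
    (C := 1) (by simp)
  have hℓ : ∀ b, ℓ b = ∫ x, ι b x ∂m := fun b => by simpa using hℓ' b
  have hdual : ∀ (u : ℝ) (n : ℕ) (g : B), ℓ ((P u ^ n) g) =
      ∫ x, ι g x * Complex.exp (Complex.I * u * birkhoffSum T φ n x) ∂m := by
    intro u n g
    have := integral_pow_apply_mul hT hφ hP u n g (h := fun _ => 1) measurable_const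
      (C := 1) (by simp)
    simpa [hℓ] using this
  have hbdd : ∀ (u : ℝ) (n : ℕ) (g : B), ‖ℓ ((P u ^ n) g)‖ ≤ ‖ι‖ * ‖g‖ := by
    intro u n g
    rw [hdual]
    have h1 : ∀ᵐ x ∂m, ‖ι g x * Complex.exp (Complex.I * u * birkhoffSum T φ n x)‖ ≤
        ‖ι‖ * ‖g‖ := by
      filter_upwards [ae_norm_le_norm_Lp_top (ι g)] with x hx
      rw [norm_mul, norm_exp_I_mul_ofReal_mul_ofReal, mul_one]
      exact hx.trans (ι.le_opNorm g)
    simpa using norm_integral_le_of_norm_le_const h1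
  have hπ := tendsto_pow_transfer hT hφ hι h_one hP hN hN_radius hℓ
  -- the central limit theorem
  have hdist : TendstoInDistribution (fun (n : ℕ) x => (√(n : ℝ))⁻¹ * birkhoffSum T φ n x) atTop
      (fun w => (W w).toFun 1) (fun _ => m) Q := by
    have h1 := hA7.continuous_comp SkorokhodSpace.continuous_eval_one
    refine h1.congr (fun n => Eventually.of_forall fun x => ?_) (Eventually.of_forall fun _ => rfl)
    simp [partialSumPath]
  have hclt : ∀ ε > (0 : ℝ), ∃ A : ℝ, ∃ δ > (0 : ℝ), ∀ u : ℝ, u ≠ 0 → |u| ≤ δ →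
      ∃ n : ℕ, n ≤ A / u ^ 2 ∧ ‖ℓ ((P u ^ n) e)‖ ≤ ε := by
    intro ε hε
    obtain ⟨A, δ, hδ, h⟩ := exists_norm_integral_exp_le hdist (Real.toNNReal_pos.2 hv)
      (hW.map_eval_one hv) hε
    refine ⟨A, δ, hδ, fun u hu0 hu => ?_⟩
    obtain ⟨n, hn, hnε⟩ := h u hu0 hu
    refine ⟨n, hn, ?_⟩
    rw [hdual]
    refine le_of_eq_of_le (congrArg _ (integral_congr_ae ?_)) hnε
    filter_upwards [h_one] with x hx
    rw [hx, one_mul]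
  -- moment bounds
  obtain ⟨ψ, R, M, hψ, hR, hM, hψR, hψM, hψf⟩ :=
    exists_fourier_representation f.continuous hf_int hf_fourier
  obtain ⟨C, hC, hsum⟩ := exists_sum_norm_pow_le hA4 ℓ e hπ hbdd hclt hA6 (4 * R)
  obtain ⟨C', hC', hmom⟩ := exists_integral_sum_pow_four_le hT hφ hP hA4 h_one hR hC hsum
  have hψs : HasCompactSupport ψ := HasCompactSupport.intro (K := Set.Icc (-R) R) isCompact_Icc
    fun ξ hξ => hψR ξ (not_le.1 fun h => hξ (abs_le.1 h))
  -- The moment bound combined with Markov's inequality, stated for a general `F` so that it serves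
  -- both the values and the increments of `l_n`.
  have hprob : ∀ (n : ℕ) (D : ℝ) (ψ' : ℝ → ℂ) (F : ℝ → ℝ), 1 ≤ n → 0 ≤ D → Continuous ψ' →
      Continuous F → (∀ ξ, R < |ξ| → ψ' ξ = 0) →
      (∀ ξ, ‖ψ' ξ‖ ≤ D * (1 + √n * |ξ|) ^ (1 / 3 : ℝ)) →
      (∀ s : ℝ, (F s : ℂ) = ∫ ξ : ℝ, ψ' ξ * Complex.exp (Complex.I * ξ * s)) → ∀ a : ℝ, 0 < a →
      m {x | a ≤ |(√(n : ℝ))⁻¹ * ∑ k ∈ Finset.range n, F (birkhoffSum T φ (k + 1) x)|} ≤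
        ENNReal.ofReal (C' * D ^ 4 / a ^ (4 : ℝ)) := by
    intro n D ψ' F hn hD hψ' hFc hψR' hψD hF a ha
    refine measure_le_abs_le_of_fourth_moment ?_ hn
      (hmom n D ψ' F hn hD hψ' hψR' hψD hF) ha
    have hFb : ∀ s, |F s| ≤ ∫ ξ, ‖ψ' ξ‖ := by
      intro s
      rw [← Real.norm_eq_abs, ← Complex.norm_real, hF]
      refine (norm_integral_le_integral_norm _).trans (le_of_eq ?_)
      simp_rw [norm_mul, norm_exp_I_mul_ofReal_mul_ofReal, mul_one]
    have hmeas : Measurable fun x => (∑ k ∈ Finset.range n, F (birkhoffSum T φ (k + 1) x)) ^ 4 :=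
      (Finset.measurable_sum _ fun k _ => hFc.measurable.comp (hS (k + 1))).pow_const 4
    refine Integrable.of_bound hmeas.aestronglyMeasurable
      ((∑ k ∈ Finset.range n, ∫ ξ, ‖ψ' ξ‖) ^ 4) (Eventually.of_forall fun x => ?_)
    rw [norm_pow, Real.norm_eq_abs]
    gcongr
    exact (Finset.abs_sum_le_sum_abs _ _).trans (Finset.sum_le_sum fun k _ => hFb _)
  -- the phase of a translate
  have htrans : ∀ (n : ℕ) (y s : ℝ), ((f (s - √(n : ℝ) * y) : ℝ) : ℂ) = ∫ ξ : ℝ,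
      (ψ ξ * Complex.exp (-(Complex.I * (ξ * (√(n : ℝ) * y) : ℝ)))) *
        Complex.exp (Complex.I * ξ * s) := by
    intro n y s
    rw [hψf]
    congr 1 with ξ
    conv_rhs => rw [mul_assoc, ← Complex.exp_add]
    push_cast
    ring_nf
  -- The exponent `1 + β = 4/3` is the fourth power of the Hölder exponent `1/3`. The constant `2 *
  -- M` is forced by the increments; for the one-point bound `M` would do, since the weight is at
  -- least one.
  have key := isTightMeasureSet_of_increments m (κ := {n : ℕ // 1 ≤ n})
    (fun n => localTime T φ f n) (fun n => measurable_localTime hT.measurable hφ f n)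
    (C := C' * (2 * M) ^ 4) (p := 4) (β := 1 / 3) (by positivity) (by norm_num) (by norm_num) ?_ ?_
  · convert key using 1
    ext ν
    simp only [Set.mem_ofPred_eq, Subtype.exists, exists_prop]
  · rintro ⟨n, hn⟩ y a ha
    simp_rw [localTime_apply]
    refine hprob n (2 * M) (fun ξ => ψ ξ * Complex.exp (-(Complex.I * (ξ * (√(n : ℝ) * y) : ℝ))))
      (fun s => f (s - √(n : ℝ) * y)) hn (by positivity) (by fun_prop) (by fun_prop)
      (fun ξ hξ => by simp [hψR ξ hξ]) (fun ξ => ?_) (htrans n y) a ha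
    have h1 : ‖Complex.exp (-(Complex.I * (ξ * (√(n : ℝ) * y) : ℝ)))‖ = 1 := by
      rw [← mul_neg, ← Complex.ofReal_neg, mul_comm, Complex.norm_exp_ofReal_mul_I]
    rw [norm_mul, h1, mul_one]
    have h2 : (1 : ℝ) ≤ (1 + √(n : ℝ) * |ξ|) ^ (1 / 3 : ℝ) := by
      refine Real.one_le_rpow ?_ (by norm_num)
      have : 0 ≤ √(n : ℝ) * |ξ| := by positivity
      linarith
    nlinarith [hψM ξ]
  · rintro ⟨n, hn⟩ y z a ha
    have hlin : ∀ x, localTime T φ f n x y - localTime T φ f n x z = (√(n : ℝ))⁻¹ *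
        ∑ k ∈ Finset.range n, (f (birkhoffSum T φ (k + 1) x - √(n : ℝ) * y) -
          f (birkhoffSum T φ (k + 1) x - √(n : ℝ) * z)) := by
      intro x
      rw [localTime_apply, localTime_apply, ← mul_sub, Finset.sum_sub_distrib]
    simp_rw [hlin]
    have hpow : C' * (2 * M) ^ 4 * |y - z| ^ (1 + 1 / 3 : ℝ) =
        C' * (2 * M * |y - z| ^ (1 / 3 : ℝ)) ^ 4 := by
      rw [mul_pow _ (|y - z| ^ (1 / 3 : ℝ)), ← Real.rpow_natCast (|y - z| ^ (1 / 3 : ℝ)),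
        ← Real.rpow_mul (abs_nonneg _), mul_assoc]
      norm_num
    rw [hpow]
    refine hprob n (2 * M * |y - z| ^ (1 / 3 : ℝ))
      (fun ξ => ψ ξ * (Complex.exp (-(Complex.I * (ξ * (√(n : ℝ) * y) : ℝ))) -
        Complex.exp (-(Complex.I * (ξ * (√(n : ℝ) * z) : ℝ)))))
      (fun s => f (s - √(n : ℝ) * y) - f (s - √(n : ℝ) * z)) hn (by positivity) (by fun_prop)
      (by fun_prop) (fun ξ hξ => by simp [hψR ξ hξ]) (fun ξ => ?_) (fun s => ?_) a ha
    · rw [norm_mul]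
      -- The phases differ by `ξ √n (y - z)`; replacing `√n |ξ|` by `1 + √n |ξ|` produces the weight
      -- required by `hprob`.
      have h1 : |ξ * (√(n : ℝ) * y) - ξ * (√(n : ℝ) * z)| ≤ |y - z| * (1 + √(n : ℝ) * |ξ|) := by
        rw [← mul_sub, ← mul_sub, abs_mul, abs_mul, abs_of_nonneg (Real.sqrt_nonneg _)]
        nlinarith [abs_nonneg (y - z)]
      calc _ ≤ M * (2 * (|y - z| * (1 + √(n : ℝ) * |ξ|)) ^ (1 / 3 : ℝ)) := by
            gcongr
            · exact hψM ξ
            · exact (norm_exp_sub_exp_le _ _).trans (by gcongr)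
        _ = _ := by
            rw [Real.mul_rpow (abs_nonneg _) (by positivity)]
            ring
    · push_cast [htrans]
      rw [← integral_sub]
      · congr 1 with ξ
        ring
      · exact (by fun_prop : Continuous _).integrable_of_hasCompactSupport
          (hψs.mul_right.mul_right)
      · exact (by fun_prop : Continuous _).integrable_of_hasCompactSupport
          (hψs.mul_right.mul_right)
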